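/- Graphs are finite undirected multigraphs in which self-loops and parallel edges are allowed; a self-loop contributes $2$ to the degree of its vertex; a cycle is given by a cyclic sequence of distinct vertices, a self-loop being a cycle of length $1$ and a double edge a cycle of length $2$; the length of a cycle is its number of vertices. All logarithms are to base $2$, and $\log^{1.5}k=(\log k)^{1.5}$. For a graph $H$, let $\mathrm{reduce}(H)$ be the graph obtained from $H$ by applying exhaustively, in any order, the following rules: (A1) delete a vertex of degree at most $1$; (A2) delete a vertex of degree exactly $2$ that carries no self-loop, and join its two (not necessarily distinct) neighbours by a new edge; (A3) reduce the multiplicity of an edge of multiplicity larger than $2$ to $2$. Let $|\mathrm{reduce}(H)|$ be its number of vertices. A feedback vertex set of $G$ is a set $F$ of vertices such that $G-F$ is a forest. Consider the following algorithm, for a constant $c$, a graph $G$, a positive integer $k$ and a real number $g>6$. First it finds either $k$ vertex-disjoint cycles in $G$, which it returns, or a feedback vertex set of $G$ of size at most $ck\log k$. In the latter case it starts with $S=\emptyset$ and repeats: find a shortest cycle $C$ of $\mathrm{reduce}(G-S)$; if there is no cycle or $C$ has length greater than $g$, return $S$; otherwise add the vertices of $C$ to $S$. If vertices are added $k$ times,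 it stops and returns $k$ vertex-disjoint cycles. Put $g=\frac{48\log k}{\log\log k}+6$. (i) Let $c>2$ be a constant and let $k$ be an integer with $\log k>c$. For every graph $G$, if the algorithm does not return $k$ vertex-disjoint cycles but a set $S$, then $$|\mathrm{reduce}(G-S)|\le 3ck\log k+2ck\log^{1.5}k .$$ (ii) There is a constant $c>2$ such that, for every integer $k\ge 1$, every graph has $k$ vertex-disjoint cycles or a feedback vertex set of size at most $ck\log k$, and such that the bound in (i) holds, with this $c$, for all integers $k\ge 3$ and all graphs $G$ without $k$ vertex-disjoint cycles, for every set $S$ returned by the algorithm. -/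

import Mathlib

universe u

/-- A finite undirected multigraph whose vertices are taken from `V`: a finite vertex set together
with a multiset of edges. An edge is an unordered pair of vertices, `s(v, v)` being a self-loop at
`v`, and the multiplicity of an edge `e` is `edges.count e`. -/
structure MultiGraph (V : Type u) where
  verts : Finset V
  edges : Multiset (Sym2 V)
  mem_verts : ∀ e ∈ edges, ∀ v ∈ e, v ∈ verts

namespace MultiGraph

variable {V : Type u} [DecidableEq V]

/-- The degree of `v`: the number of edges incident to `v`, where self-loops count twice. -/
def degree (G : MultiGraph V) (v : V) : ℕ :=
  (G.edges.filter (fun e => v ∈ e)).card + G.edges.count s(v, v)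

/-- `G - S`: delete the vertices in `S` and every edge incident to one of them. -/
def deleteVerts (G : MultiGraph V) (S : Finset V) : MultiGraph V where
  verts := G.verts \ S
  edges := G.edges.filter (fun e => ∀ v ∈ S, v ∉ e)
  mem_verts := by
    intro e he v hv
    rw [Multiset.mem_filter] at he
    exact Finset.mem_sdiff.mpr ⟨G.mem_verts e he.1 v hv, fun hS => he.2 v hS hv⟩

/-- The multiset of edges that a cyclic sequence `v₀, …, vₙ₋₁` runs through, namely
`{v₀, v₁}, …, {vₙ₋₂, vₙ₋₁}, {vₙ₋₁, v₀}`. -/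
def cycleEdges (C : List V) : Multiset (Sym2 V) :=
  (List.zipWith (fun a b => s(a, b)) C (C.rotate 1) : List (Sym2 V))

/-- `C` is (the vertex sequence of) a cycle of `G`: a nonempty sequence of distinct vertices whose
cyclically consecutive pairs are edges of `G`. As multiplicities are compared, a sequence of length
one is a cycle iff there is a self-loop, and one of length two iff there is a double edge. The
length of the cycle is `C.length`, its number of vertices. -/
def IsCycle (G : MultiGraph V) (C : List V) : Prop :=
  C ≠ [] ∧ C.Nodup ∧ cycleEdges C ≤ G.edges

/-- `C` is a shortest cycle of `G`. -/
def IsShortestCycle (G : MultiGraph V) (C : List V) : Prop :=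
  G.IsCycle C ∧ ∀ C' : List V, G.IsCycle C' → C.length ≤ C'.length

/-- `G` contains `k` pairwise vertex-disjoint cycles. -/
def HasDisjointCycles (G : MultiGraph V) (k : ℕ) : Prop :=
  ∃ C : Fin k → List V, (∀ i, G.IsCycle (C i)) ∧ ∀ i j, i ≠ j → List.Disjoint (C i) (C j)

/-- `F` is a feedback vertex set of `G`: a set of vertices such that `G - F` is a forest. -/
def IsFeedbackVertexSet (G : MultiGraph V) (F : Finset V) : Prop :=
  F ⊆ G.verts ∧ ∀ C : List V, ¬ (G.deleteVerts F).IsCycle C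

/-- One application of a reduction rule, turning `G` into `G'`. -/
inductive ReductionStep (G G' : MultiGraph V) : Prop
  /-- Delete a vertex of degree at most one. -/
  | deleteLeaf (v : V) (hv : v ∈ G.verts) (hdeg : G.degree v ≤ 1)
      (h : G' = G.deleteVerts {v})
  /-- Delete a vertex `v` of degree exactly two without a self-loop, and join its two (not
  necessarily distinct) neighbours `x` and `y` by a new edge. -/
  | bypass (v x y : V) (hv : v ∈ G.verts) (hdeg : G.degree v = 2) (hloop : s(v, v) ∉ G.edges)
      (hxy : G.edges.filter (fun e => v ∈ e) = {s(v, x), s(v, y)})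
      (hverts : G'.verts = (G.deleteVerts {v}).verts)
      (hedges : G'.edges = s(x, y) ::ₘ (G.deleteVerts {v}).edges)
  /-- Reduce the multiplicity of an edge (possibly a self-loop) of multiplicity larger than two
  to two. -/
  | trim (e : Sym2 V) (he : 2 < G.edges.count e)
      (hverts : G'.verts = G.verts)
      (hedges : G'.edges = Multiset.replicate 2 e + G.edges.filter (fun e' => e' ≠ e))

/-- `R` is `reduce(G)`: it results from `G` by exhaustive application of the reduction rules (in
any order). -/
def IsReduce (G R : MultiGraph V) : Prop :=
  Relation.ReflTransGen ReductionStep G R ∧ ∀ R' : MultiGraph V, ¬ ReductionStep R R'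

/-- The iterative removal of short cycles. `ShortCycleRemoval G g m S` says that after `m` rounds
the vertices deleted so far form the set `S`; a round finds a shortest cycle `C` of
`reduce(G - S)` and, if its length is at most `g`, adds its vertices to `S`. -/
inductive ShortCycleRemoval (G : MultiGraph V) (g : ℝ) : ℕ → Finset V → Prop
  | start : ShortCycleRemoval G g 0 ∅
  | round {m : ℕ} {S : Finset V} (R : MultiGraph V) (C : List V)
      (hS : ShortCycleRemoval G g m S) (hR : (G.deleteVerts S).IsReduce R)
      (hC : R.IsShortestCycle C) (hlen : (C.length : ℝ) ≤ g) :
      ShortCycleRemoval G g (m + 1) (S ∪ C.toFinset)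

/-- The packing algorithm, run on `G`, `k` and `g`, returns the set `S` (and not `k` vertex-disjoint
cycles), `R` being the graph `reduce(G - S)` examined last. Its first stage found a feedback vertex
set of size at most `c k log k` (instead of `k` vertex-disjoint cycles); its second stage stopped
after fewer than `k` rounds because `reduce(G - S)` has no cycle of length at most `g`. -/
def AlgorithmReturns (c : ℝ) (G : MultiGraph V) (k : ℕ) (g : ℝ) (S : Finset V)
    (R : MultiGraph V) : Prop :=
  (∃ F : Finset V, G.IsFeedbackVertexSet F ∧ (F.card : ℝ) ≤ c * k * Real.logb 2 k) ∧
  ∃ m < k, G.ShortCycleRemoval g m S ∧ (G.deleteVerts S).IsReduce R ∧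
    ∀ C : List V, R.IsShortestCycle C → g < C.length

end MultiGraph

/-- `c` is a constant for which the Erdős–Pósa theorem holds: every multigraph has `k`
vertex-disjoint cycles or a feedback vertex set of size at most `c k log k`. -/
def IsErdosPosaConstant (c : ℝ) : Prop :=
  ∀ (V : Type u) [DecidableEq V] (G : MultiGraph V) (k : ℕ),
    G.HasDisjointCycles k ∨
      ∃ F : Finset V, G.IsFeedbackVertexSet F ∧ (F.card : ℝ) ≤ c * k * Real.logb 2 k

/-- The girth parameter `g = 48 log k / log log k + 6`. -/
noncomputable def girthParameter (k : ℕ) : ℝ :=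
  48 * Real.logb 2 k / Real.logb 2 (Real.logb 2 k) + 6

/-! Everything is read off the last graph R = reduce(G − S). It is irreducible, has no cycle of
length at most g, and inherits from G a set F of at most r vertices meeting all its cycles, since
each reduction rule turns a hitting set into one that is no larger (`ReductionStep.exists_hits`).
Irreducibility and girth make R a simple graph of minimum degree three, and T = R − F is a forest.

Suppose |T| > 2(1+x)|F|, and let i be the number of isolated vertices of T. Counting degrees, T
sends at least |T| + 2i edges to F, while T has a dominating set D of size at most (|T|+i)/2.
Contracting stars around D yields a bipartite graph on F ∪ D with more edges than the total weight,
where vertices of F weigh 1+x and those of D weigh 1. Hence some subgraph has degrees above 1+x on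
the F side and at least 2 on the D side. Breadth-first search in it gains a factor x every two
levels. Contraction at most halves the girth, so girth above 8h leaves 2h tree-like levels, and x^h
≤ |F| (`LocallySparse.pow_le_card_of_forest`). For x = K√(log k) and h = ⌊g/8⌋ this contradicts |F|
≤ r, so |R| ≤ (3+2x)r.

Cycles are traded for dense sets, which span at least as many edges as vertices, and girth for local
sparsity; arguments about paths become edge counts. `Dense.exists_isCycle` translates back. The
existence of an Erdős–Pósa constant follows by induction on k from the same size bound with x = 2
(`exists_disjoint_dense_or_hits`). -/

namespace SimpleGraph

variable {α : Type*}

/-! ### Edge counts and local sparsity in simple graphs -/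

open Classical in
/-- The ordered pairs of adjacent vertices inside `W`; twice as many as the edges inside `W`. -/
noncomputable def adjPairs (G : SimpleGraph α) (W : Finset α) : Finset (α × α) :=
  (W ×ˢ W).filter fun p => G.Adj p.1 p.2

open Classical in
/-- The neighbours of `v` inside `W`. -/
noncomputable def nbrs (G : SimpleGraph α) (W : Finset α) (v : α) : Finset α :=
  W.filter fun w => G.Adj v w

/-- Every nonempty set of at most `g` vertices of `X` spans fewer edges than it has vertices. -/
def LocallySparse (G : SimpleGraph α) (X : Finset α) (g : ℕ) : Prop :=
  ∀ W ⊆ X, W.Nonempty → W.card ≤ g → (G.adjPairs W).card + 2 ≤ 2 * W.card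

variable (G : SimpleGraph α)

lemma mem_adjPairs {W : Finset α} {p : α × α} :
    p ∈ G.adjPairs W ↔ (p.1 ∈ W ∧ p.2 ∈ W) ∧ G.Adj p.1 p.2 := by
  simp [adjPairs]

lemma mem_nbrs {W : Finset α} {v w : α} : w ∈ G.nbrs W v ↔ w ∈ W ∧ G.Adj v w := by
  simp [nbrs]

variable {G}

lemma LocallySparse.mono {X Y : Finset α} {g h : ℕ} (H : G.LocallySparse X g) (hY : Y ⊆ X)
    (hg : h ≤ g) : G.LocallySparse Y h :=
  fun W hW hne hc => H W (hW.trans hY) hne (hc.trans hg)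

variable (G)

lemma card_adjPairs_eq_sum (W : Finset α) :
    (G.adjPairs W).card = ∑ v ∈ W, (G.nbrs W v).card := by
  classical
  rw [← Finset.card_sigma]
  refine Finset.card_bij' (fun p _ => ⟨p.1, p.2⟩) (fun q _ => (q.1, q.2)) ?_ ?_ ?_ ?_
  · intro p hp
    rw [mem_adjPairs] at hp
    simp [mem_nbrs, hp.1.1, hp.1.2, hp.2]
  · rintro ⟨a, b⟩ hq
    simp only [Finset.mem_sigma, mem_nbrs] at hq
    simp [mem_adjPairs, hq.1, hq.2.1, hq.2.2]
  · intro p _; rfl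
  · intro q _; rfl

/-- Counting the pairs of adjacent vertices between two sets from either side. -/
lemma sum_card_nbrs_comm (A B : Finset α) :
    ∑ v ∈ A, (G.nbrs B v).card = ∑ w ∈ B, (G.nbrs A w).card := by
  classical
  have := Finset.sum_card_bipartiteAbove_eq_sum_card_bipartiteBelow (s := A) (t := B) G.Adj
  simp only [Finset.bipartiteAbove, Finset.bipartiteBelow] at this
  simp only [nbrs]
  convert this using 4
  · rw [G.adj_comm]

variable [DecidableEq α]

lemma card_adjPairs_insert {W : Finset α} {v : α} (hv : v ∉ W) :
    (G.adjPairs (insert v W)).card = (G.adjPairs W).card + 2 * (G.nbrs W v).card := by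
  have h0 : G.nbrs (insert v W) v = G.nbrs W v := by
    ext w; simp only [mem_nbrs, Finset.mem_insert]
    constructor
    · rintro ⟨rfl | h, h'⟩
      · exact absurd h' (G.loopless.irrefl _)
      · exact ⟨h, h'⟩
    · exact fun h => ⟨Or.inr h.1, h.2⟩
  have h1 : ∀ w ∈ W, (G.nbrs (insert v W) w).card
      = (G.nbrs W w).card + (G.nbrs {v} w).card := by
    intro w _
    rw [← Finset.card_union_of_disjoint]
    · congr 1; ext z; simp only [mem_nbrs, Finset.mem_insert, Finset.mem_union,
        Finset.mem_singleton]; tauto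
    · rw [Finset.disjoint_left]
      intro z hz hz'
      rw [mem_nbrs] at hz hz'
      exact hv (Finset.mem_singleton.mp hz'.1 ▸ hz.1)
  rw [card_adjPairs_eq_sum, Finset.sum_insert hv, h0, Finset.sum_congr rfl h1,
    Finset.sum_add_distrib, ← card_adjPairs_eq_sum, G.sum_card_nbrs_comm W {v},
    Finset.sum_singleton]
  ring

/-- Supermodularity: a pair lying inside both sets lies inside their intersection. -/
lemma card_adjPairs_add_le (A B : Finset α) :
    (G.adjPairs A).card + (G.adjPairs B).card
      ≤ (G.adjPairs (A ∪ B)).card + (G.adjPairs (A ∩ B)).card := by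
  rw [← Finset.card_union_add_card_inter]
  refine add_le_add (Finset.card_le_card ?_) (Finset.card_le_card ?_)
  · intro p hp
    simp only [Finset.mem_union, mem_adjPairs] at hp ⊢; tauto
  · intro p hp
    simp only [Finset.mem_inter, mem_adjPairs] at hp ⊢; tauto

lemma two_mul_card_le_card_adjPairs {W : Finset α} {S : Finset (α × α)}
    (hS : S ⊆ G.adjPairs W) (hswap : ∀ p ∈ S, p.swap ∉ S) :
    2 * S.card ≤ (G.adjPairs W).card := by
  have hd : Disjoint S (S.image Prod.swap) := by
    rw [Finset.disjoint_left]
    intro p hp hp'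
    obtain ⟨q, hq, rfl⟩ := Finset.mem_image.mp hp'
    exact hswap q hq hp
  have hc : (S.image Prod.swap).card = S.card :=
    Finset.card_image_of_injective _ Prod.swap_injective
  calc 2 * S.card = (S ∪ S.image Prod.swap).card := by
        rw [Finset.card_union_of_disjoint hd, hc]; ring
    _ ≤ _ := by
        refine Finset.card_le_card (Finset.union_subset hS ?_)
        intro p hp
        obtain ⟨q, hq, rfl⟩ := Finset.mem_image.mp hp
        have := G.mem_adjPairs.mp (hS hq)
        exact G.mem_adjPairs.mpr ⟨⟨this.1.2, this.1.1⟩, this.2.symm⟩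

variable {G}

/-- Call a set tight if it spans at least |A| − 1 edges, as connected sets do. By supermodularity
the union keeps every edge that the sparse intersection cannot hold. Tight sets thus stand in for
paths from the root. -/
lemma LocallySparse.union_tight {X A B : Finset α} {g : ℕ} (H : G.LocallySparse X g)
    (hAX : A ⊆ X) (hne : (A ∩ B).Nonempty) (hg : A.card ≤ g)
    (hA : 2 * A.card ≤ (G.adjPairs A).card + 2) (hB : 2 * B.card ≤ (G.adjPairs B).card + 2) :
    2 * (A ∪ B).card ≤ (G.adjPairs (A ∪ B)).card + 2 := by
  have h1 := H (A ∩ B) (Finset.inter_subset_left.trans hAX) hne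
    ((Finset.card_le_card Finset.inter_subset_left).trans hg)
  have h2 := G.card_adjPairs_add_le A B
  have h3 := Finset.card_union_add_card_inter A B
  omega

/-! ### Breadth-first search -/

/-- The vertices of `X` that can be reached from `r` by at most `i` steps inside `X`. -/
noncomputable def closedBall (G : SimpleGraph α) (X : Finset α) (r : α) : ℕ → Finset α
  | 0 => {r}
  | i + 1 => closedBall G X r i ∪ X.filter fun v => (G.nbrs (closedBall G X r i) v).Nonempty

lemma closedBall_subset {X : Finset α} {r : α} (hr : r ∈ X) (i : ℕ) : G.closedBall X r i ⊆ X := by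
  induction i with
  | zero => simpa [closedBall] using hr
  | succ i ih => exact Finset.union_subset ih (Finset.filter_subset _ _)

lemma mem_closedBall_succ {X : Finset α} {r v : α} {i : ℕ} :
    v ∈ G.closedBall X r (i + 1) ↔
      v ∈ G.closedBall X r i ∨ (v ∈ X ∧ ∃ u ∈ G.closedBall X r i, G.Adj u v) := by
  rw [closedBall, Finset.mem_union, Finset.mem_filter]
  simp only [Finset.Nonempty, mem_nbrs, G.adj_comm v]

/-- The set A is the vertex set of a path from r to v. The last clause, that all its other vertices
are closer to r, later keeps a new vertex outside A. -/
lemma exists_tight_of_mem_closedBall {X : Finset α} {r : α} (hr : r ∈ X) (i : ℕ) :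
    ∀ v ∈ G.closedBall X r i, ∃ A ⊆ X, r ∈ A ∧ v ∈ A ∧ A.card ≤ i + 1 ∧
      2 * A.card ≤ (G.adjPairs A).card + 2 ∧
      ∀ w ∈ A, w = v ∨ ∃ j < i, w ∈ G.closedBall X r j := by
  induction i with
  | zero =>
    intro v hv
    obtain rfl : v = r := by simpa [closedBall] using hv
    exact ⟨{v}, by simpa using hr, by simp, by simp, by simp, by simp, by simp⟩
  | succ i ih =>
    intro v hv
    rcases mem_closedBall_succ.mp hv with h | ⟨hvX, u, hu, huv⟩
    · obtain ⟨A, h1, h2, h3, h4, h5, h6⟩ := ih v h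
      refine ⟨A, h1, h2, h3, by omega, h5, fun w hw => ?_⟩
      rcases h6 w hw with h | ⟨j, hj, hw⟩
      · exact Or.inl h
      · exact Or.inr ⟨j, by omega, hw⟩
    · obtain ⟨A, h1, h2, h3, h4, h5, h6⟩ := ih u hu
      have hA : ∀ w ∈ A, ∃ j < i + 1, w ∈ G.closedBall X r j := by
        intro w hw
        rcases h6 w hw with rfl | ⟨j, hj, hw⟩
        · exact ⟨i, by omega, hu⟩
        · exact ⟨j, by omega, hw⟩
      by_cases hvA : v ∈ A
      · exact ⟨A, h1, h2, hvA, by omega, h5, fun w hw => Or.inr (hA w hw)⟩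
      · refine ⟨insert v A, Finset.insert_subset hvX h1, by simp [h2], by simp, ?_, ?_, ?_⟩
        · rw [Finset.card_insert_of_notMem hvA]; omega
        · have : 0 < (G.nbrs A v).card :=
            Finset.card_pos.mpr ⟨u, G.mem_nbrs.mpr ⟨h3, huv.symm⟩⟩
          rw [Finset.card_insert_of_notMem hvA, G.card_adjPairs_insert hvA]; omega
        · intro w hw
          rcases Finset.mem_insert.mp hw with rfl | hw
          · exact Or.inl rfl
          · exact Or.inr (hA w hw)

/-- Two neighbours in the ball would give two tight sets through r with a tight union of at most 2i
+ 1 vertices. Adding v brings two more edges, so at most 2i + 2 ≤ 2m vertices would span as many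
edges as vertices. As v may itself lie in the ball of radius i, edges inside a level are covered
too. -/
lemma LocallySparse.card_nbrs_closedBall_le_one {X : Finset α} {m i : ℕ}
    (H : G.LocallySparse X (2 * m)) {r v : α} (hr : r ∈ X) (hi : i < m) (hv : v ∈ X)
    (hvi : ∀ j < i, v ∉ G.closedBall X r j) :
    (G.nbrs (G.closedBall X r i) v).card ≤ 1 := by
  rw [Finset.card_le_one]
  intro u hu u' hu'
  by_contra hne
  rw [mem_nbrs] at hu hu'
  obtain ⟨A, h1, h2, h3, h4, h5, h6⟩ := exists_tight_of_mem_closedBall hr i u hu.1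
  obtain ⟨B, k1, k2, k3, k4, k5, k6⟩ := exists_tight_of_mem_closedBall hr i u' hu'.1
  have hvA : v ∉ A ∪ B := by
    intro hvA
    rcases Finset.mem_union.mp hvA with h | h
    · rcases h6 v h with rfl | ⟨j, hj, h⟩
      · exact G.loopless.irrefl _ hu.2
      · exact hvi j hj h
    · rcases k6 v h with rfl | ⟨j, hj, h⟩
      · exact G.loopless.irrefl _ hu'.2
      · exact hvi j hj h
  have hr' : (A ∩ B).Nonempty := ⟨r, Finset.mem_inter.mpr ⟨h2, k2⟩⟩
  have ht := H.union_tight h1 hr' (by omega) h5 k5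
  have hcard := Finset.card_union_add_card_inter A B
  have hpos := Finset.card_pos.mpr hr'
  have hn : 2 ≤ (G.nbrs (A ∪ B) v).card := by
    rw [← Finset.card_pair hne]
    refine Finset.card_le_card ?_
    intro w hw
    rw [mem_nbrs]
    rcases Finset.mem_insert.mp hw with rfl | hw
    · exact ⟨Finset.mem_union_left _ h3, hu.2⟩
    · obtain rfl := Finset.mem_singleton.mp hw
      exact ⟨Finset.mem_union_right _ k3, hu'.2⟩
  have hins := G.card_adjPairs_insert hvA
  have hci := Finset.card_insert_of_notMem hvA
  have := H (insert v (A ∪ B)) (Finset.insert_subset hv (Finset.union_subset h1 k1))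
    (Finset.insert_nonempty _ _) (by omega)
  omega

/-- Breadth-first search in a locally sparse graph: the levels grow as in a tree. -/
theorem LocallySparse.exists_levels {X : Finset α} {m : ℕ} (H : G.LocallySparse X (2 * m))
    {r : α} (hr : r ∈ X) :
    ∃ L : ℕ → Finset α, L 0 = {r} ∧ (∀ i, L i ⊆ X) ∧
      (∀ i, ∀ v ∈ L (i + 1), ∃ u ∈ L i, G.Adj u v) ∧
      ∀ i < m, ∑ v ∈ L i, (G.nbrs X v).card ≤ (L (i + 1)).card + (L i).card := by
  classical
  set B := G.closedBall X r with hB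
  have hBX := closedBall_subset (G := G) hr
  let L : ℕ → Finset α := fun i => (B i).filter fun v => ∀ j < i, v ∉ B j
  have hmem : ∀ i v, v ∈ L i ↔ v ∈ B i ∧ ∀ j < i, v ∉ B j := fun i v => by simp [L]
  have hLX : ∀ i, L i ⊆ X := fun i v hv => hBX i ((hmem i v).mp hv).1
  refine ⟨L, ?_, hLX, ?_, ?_⟩
  · ext v; simp [L, hB, closedBall]
  · intro i v hv
    rw [hmem] at hv
    rcases mem_closedBall_succ.mp hv.1 with h | ⟨hvX, u, hu, huv⟩
    · exact absurd h (hv.2 i (by omega))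
    · refine ⟨u, (hmem _ _).mpr ⟨hu, fun j hj huj => ?_⟩, huv⟩
      exact hv.2 (j + 1) (by omega) (mem_closedBall_succ.mpr (Or.inr ⟨hvX, u, huj, huv⟩))
  · intro i hi
    -- At most one neighbour of v lies in the ball of radius i; all others are in the next level.
    have h1 : ∀ v ∈ L i, (G.nbrs X v).card ≤ (G.nbrs (L (i + 1)) v).card + 1 := by
      intro v hv
      have hv' := (hmem i v).mp hv
      refine le_trans (Finset.card_le_card (t := G.nbrs (L (i + 1)) v ∪ G.nbrs (B i) v) ?_)
        ((Finset.card_union_le _ _).trans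
          (Nat.add_le_add_left (H.card_nbrs_closedBall_le_one hr hi (hLX i hv) hv'.2) _))
      intro w hw
      rw [mem_nbrs] at hw
      rw [Finset.mem_union, mem_nbrs, mem_nbrs]
      have hmono : Monotone B := monotone_nat_of_le_succ fun n =>
        fun x hx => mem_closedBall_succ.mpr (Or.inl hx)
      by_cases hwB : w ∈ B i
      · exact Or.inr ⟨hwB, hw.2⟩
      · refine Or.inl ⟨(hmem _ _).mpr ⟨mem_closedBall_succ.mpr
          (Or.inr ⟨hw.1, v, hv'.1, hw.2⟩), fun j hj hwj => hwB ?_⟩, hw.2⟩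
        exact hmono (by omega : j ≤ i) hwj
    have h2 : ∀ w ∈ L (i + 1), (G.nbrs (L i) w).card ≤ 1 := by
      intro w hw
      have hw' := (hmem _ _).mp hw
      refine le_trans (Finset.card_le_card ?_) (H.card_nbrs_closedBall_le_one hr hi (hLX _ hw)
        fun j hj => hw'.2 j (by omega))
      intro u hu
      rw [mem_nbrs] at hu ⊢
      exact ⟨((hmem _ _).mp hu.1).1, hu.2⟩
    calc ∑ v ∈ L i, (G.nbrs X v).card
        ≤ ∑ v ∈ L i, ((G.nbrs (L (i + 1)) v).card + 1) := Finset.sum_le_sum h1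
      _ = ∑ w ∈ L (i + 1), (G.nbrs (L i) w).card + (L i).card := by
          rw [Finset.sum_add_distrib, G.sum_card_nbrs_comm]; simp
      _ ≤ _ := by
          refine Nat.add_le_add_right ?_ _
          simpa using Finset.sum_le_card_nsmul _ _ 1 h2

/-- A locally sparse graph of minimum degree at least three is exponentially large. -/
theorem LocallySparse.two_pow_le_card {X : Finset α} {m : ℕ} (H : G.LocallySparse X (2 * m))
    (hX : X.Nonempty) (hdeg : ∀ v ∈ X, 3 ≤ (G.nbrs X v).card) : 2 ^ m ≤ X.card := by
  obtain ⟨r, hr⟩ := hX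
  obtain ⟨L, h0, hLX, -, hL⟩ := H.exists_levels hr
  have : ∀ i ≤ m, 2 ^ i ≤ (L i).card := by
    intro i
    induction i with
    | zero => simp [h0]
    | succ i ih =>
      intro hi
      have h1 := ih (by omega)
      have h2 := hL i (by omega)
      have h3 := Finset.card_nsmul_le_sum (L i) (fun v => (G.nbrs X v).card) 3
        fun v hv => hdeg v (hLX i hv)
      rw [smul_eq_mul] at h3
      rw [pow_succ]; omega
  exact (this m le_rfl).trans (Finset.card_le_card (hLX m))

/-! ### Subgraphs of large weighted degree, and dominating sets -/

/-- If a vertex set spans more edges than its total weight, then some nonempty subset of it induces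
a graph all of whose degrees exceed the weights. -/
theorem exists_subset_weight_lt_card_nbrs (wt : α → ℝ) (Y : Finset α)
    (hY : 2 * ∑ v ∈ Y, wt v < (G.adjPairs Y).card) :
    ∃ Z ⊆ Y, Z.Nonempty ∧ ∀ v ∈ Z, wt v < (G.nbrs Z v).card := by
  induction Y using Finset.strongInduction with
  | H Y ih =>
    by_cases hall : ∀ v ∈ Y, wt v < (G.nbrs Y v).card
    · refine ⟨Y, subset_rfl, ?_, hall⟩
      rw [Finset.nonempty_iff_ne_empty]
      rintro rfl
      simp [adjPairs] at hY
    · push Not at hall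
      -- Deleting v loses at most `wt v` edges and exactly `wt v` of weight, so the excess survives.
      obtain ⟨v, hv, hle⟩ := hall
      have hnot := Finset.notMem_erase v Y
      have hP := G.card_adjPairs_insert hnot
      have hn : (G.nbrs (Y.erase v) v).card ≤ (G.nbrs Y v).card := by
        refine Finset.card_le_card fun w hw => ?_
        rw [mem_nbrs] at hw ⊢
        exact ⟨Finset.mem_of_mem_erase hw.1, hw.2⟩
      rw [Finset.insert_erase hv] at hP
      have hs := Finset.add_sum_erase Y wt hv
      have hn' : ((G.nbrs (Y.erase v) v).card : ℝ) ≤ (G.nbrs Y v).card := by exact_mod_cast hn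
      rw [hP] at hY
      push_cast at hY
      obtain ⟨Z, hZ, h⟩ := ih (Y.erase v) (Finset.erase_ssubset hv) (by linarith)
      exact ⟨Z, hZ.trans (Finset.erase_subset _ _), h⟩

open Classical in
/-- The vertices of `T` without neighbours in `T`. -/
noncomputable def isolated (G : SimpleGraph α) (T : Finset α) : Finset α :=
  T.filter fun v => G.nbrs T v = ∅

/-- Ore's bound for dominating sets, with isolated vertices taken into account. -/
theorem exists_dominating_card_le (T : Finset α) :
    ∃ D ⊆ T, (∀ v ∈ T, v ∉ D → ∃ c ∈ D, G.Adj v c) ∧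
      2 * D.card ≤ T.card + (G.isolated T).card := by
  classical
  have hex : ∃ D ∈ T.powerset.filter (fun D => ∀ v ∈ T, v ∉ D → ∃ c ∈ D, G.Adj v c),
      ∀ D' ∈ T.powerset.filter (fun D => ∀ v ∈ T, v ∉ D → ∃ c ∈ D, G.Adj v c),
        D.card ≤ D'.card :=
    Finset.exists_min_image _ _ ⟨T, by simp +contextual⟩
  obtain ⟨D, hD, hmin⟩ := hex
  simp only [Finset.mem_filter, Finset.mem_powerset] at hD hmin
  refine ⟨D, hD.1, hD.2, ?_⟩
  -- The complement of a minimum dominating set, together with the isolated vertices, dominates as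
  -- well.
  have h1 : D.card ≤ ((T \ D) ∪ G.isolated T).card := by
    refine hmin _ ⟨Finset.union_subset Finset.sdiff_subset (Finset.filter_subset _ _), ?_⟩
    intro d hd hdn
    simp only [Finset.mem_union, Finset.mem_sdiff, hd, true_and, not_or, not_not] at hdn
    obtain ⟨hdD, hiso⟩ := hdn
    by_contra hno
    push Not at hno
    have hne : (G.nbrs T d).Nonempty := by
      rw [Finset.nonempty_iff_ne_empty]
      intro h
      exact hiso (Finset.mem_filter.mpr ⟨hd, h⟩)
    obtain ⟨e, he⟩ := hne
    rw [mem_nbrs] at he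
    have hdom : ∀ v ∈ T, v ∉ D → ¬ G.Adj d v := fun v hv hvD =>
      hno v (Finset.mem_union_left _ (Finset.mem_sdiff.mpr ⟨hv, hvD⟩))
    have heD : e ∈ D := by
      by_contra h
      exact hdom e he.1 h he.2
    -- No vertex outside D depends on d, and d is dominated by e, so d could be dropped.
    have := hmin (D.erase d) ⟨(Finset.erase_subset _ _).trans hD.1, ?_⟩
    · rw [Finset.card_erase_of_mem hdD] at this
      have := Finset.card_pos.mpr ⟨d, hdD⟩
      omega
    · intro v hv hvD
      by_cases hvd : v = d
      · subst hvd
        exact ⟨e, Finset.mem_erase.mpr ⟨he.2.ne', heD⟩, he.2⟩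
      · have hvD' : v ∉ D := fun h => hvD (Finset.mem_erase.mpr ⟨hvd, h⟩)
        obtain ⟨c, hc, hvc⟩ := hD.2 v hv hvD'
        refine ⟨c, Finset.mem_erase.mpr ⟨?_, hc⟩, hvc⟩
        rintro rfl
        exact hdom v hv hvD' hvc.symm
  have h2 := Finset.card_union_le (T \ D) (G.isolated T)
  have h3 := Finset.card_sdiff_add_card_eq_card hD.1
  omega

end SimpleGraph

/-! ### Contracting a forest onto a dominating set -/

namespace SimpleGraph

variable {α : Type*} [DecidableEq α]

/-- A forest `T` in which every vertex has degree at least three in `T ∪ F` sends many edges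
to `F`. -/
lemma card_add_isolated_le_sum_nbrs {G : SimpleGraph α} {T F : Finset α}
    (hforest : G.LocallySparse T T.card)
    (hdeg : ∀ v ∈ T, 3 ≤ (G.nbrs T v).card + (G.nbrs F v).card) :
    T.card + 2 * (G.isolated T).card ≤ ∑ v ∈ T, (G.nbrs F v).card := by
  have h1 : 3 * T.card ≤ (G.adjPairs T).card + ∑ v ∈ T, (G.nbrs F v).card := by
    rw [card_adjPairs_eq_sum, ← Finset.sum_add_distrib]
    simpa [mul_comm] using Finset.card_nsmul_le_sum T _ 3 hdeg
  have hsub : G.isolated T ⊆ T := Finset.filter_subset _ _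
  have hc := Finset.card_sdiff_add_card_eq_card hsub
  -- Only non-isolated vertices carry forest edges; this gains the term that pays for the isolated
  -- vertices in the dominating set.
  have h2 : (G.adjPairs T).card ≤ 2 * (T \ G.isolated T).card := by
    have hP : G.adjPairs T ⊆ G.adjPairs (T \ G.isolated T) := by
      intro p hp
      rw [mem_adjPairs] at hp ⊢
      have hn : ∀ a b : α, a ∈ T → b ∈ T → G.Adj a b → a ∈ T \ G.isolated T := by
        intro a b ha hb hab
        refine Finset.mem_sdiff.mpr ⟨ha, fun hi => ?_⟩
        have := (Finset.mem_filter.mp hi).2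
        exact Finset.notMem_empty b (this ▸ G.mem_nbrs.mpr ⟨hb, hab⟩)
      exact ⟨⟨hn _ _ hp.1.1 hp.1.2 hp.2, hn _ _ hp.1.2 hp.1.1 hp.2.symm⟩, hp.2⟩
    refine (Finset.card_le_card hP).trans ?_
    rcases Finset.eq_empty_or_nonempty (T \ G.isolated T) with h | h
    · simp [h, adjPairs]
    · have := hforest _ Finset.sdiff_subset h (Finset.card_le_card Finset.sdiff_subset)
      omega
  omega

/-- The graph on `F ∪ D` that arises by contracting the fibres of `φ : T → D`, keeping only the
edges between `T` and `F`. -/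
def starContraction (G : SimpleGraph α) (T F D : Finset α) (φ : α → α) : SimpleGraph α :=
  SimpleGraph.fromRel fun c f => c ∈ D ∧ f ∈ F ∧ ∃ v ∈ T, φ v = c ∧ G.Adj v f

open Classical in
/-- The edges of `starContraction` inside `W`, directed from `D` to `F`. -/
noncomputable def starEdges (G : SimpleGraph α) (T F D : Finset α) (φ : α → α) (W : Finset α) :
    Finset (α × α) :=
  (W ×ˢ W).filter fun p => p.1 ∈ D ∧ p.2 ∈ F ∧ ∃ v ∈ T, φ v = p.1 ∧ G.Adj v p.2

section Star

variable {G : SimpleGraph α} {T F D : Finset α} {φ : α → α}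

lemma mem_starEdges {W : Finset α} {p : α × α} : p ∈ G.starEdges T F D φ W ↔
    (p.1 ∈ W ∧ p.2 ∈ W) ∧ p.1 ∈ D ∧ p.2 ∈ F ∧ ∃ v ∈ T, φ v = p.1 ∧ G.Adj v p.2 := by
  simp [starEdges]

lemma card_adjPairs_starContraction (hTF : Disjoint T F) (hD : D ⊆ T) (W : Finset α) :
    ((G.starContraction T F D φ).adjPairs W).card = 2 * (G.starEdges T F D φ W).card := by
  have hne : ∀ a b : α, a ∈ D → b ∈ F → a ≠ b := by
    rintro a b ha hb rfl
    exact Finset.disjoint_left.mp hTF (hD ha) hb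
  apply le_antisymm
  · have hsub : (G.starContraction T F D φ).adjPairs W ⊆
        G.starEdges T F D φ W ∪ (G.starEdges T F D φ W).image Prod.swap := by
      rintro ⟨a, b⟩ hp
      rw [mem_adjPairs] at hp
      obtain ⟨⟨ha, hb⟩, -, h | h⟩ := hp
      · exact Finset.mem_union_left _ (mem_starEdges.mpr ⟨⟨ha, hb⟩, h⟩)
      · exact Finset.mem_union_right _ (Finset.mem_image.mpr
          ⟨(b, a), mem_starEdges.mpr ⟨⟨hb, ha⟩, h⟩, rfl⟩)
    refine (Finset.card_le_card hsub).trans ((Finset.card_union_le _ _).trans ?_)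
    have := Finset.card_image_le (s := G.starEdges T F D φ W) (f := Prod.swap)
    omega
  · refine two_mul_card_le_card_adjPairs _ ?_ ?_
    · intro p hp
      obtain ⟨h1, h2⟩ := mem_starEdges.mp hp
      exact (mem_adjPairs _).mpr ⟨h1, hne _ _ h2.1 h2.2.1, Or.inl h2⟩
    · intro p hp hp'
      obtain ⟨-, h1, -⟩ := mem_starEdges.mp hp
      obtain ⟨-, -, h2, -⟩ := mem_starEdges.mp hp'
      exact hne _ _ h1 h2 rfl

/-- A set W with too many contracted edges lifts to one in G: each of |W| chosen edges needs at most
one extra vertex of T, and that vertex brings its own edge to its centre. The vertex count at most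
doubles, hence the factor 2. -/
lemma LocallySparse.starContraction {X : Finset α} {g : ℕ} (H : G.LocallySparse X (2 * g))
    (hTX : T ⊆ X) (hFX : F ⊆ X) (hTF : Disjoint T F) (hD : D ⊆ T)
    (hφ : ∀ v ∈ T, φ v ∈ D ∧ (φ v = v ∨ G.Adj v (φ v))) :
    (G.starContraction T F D φ).LocallySparse (F ∪ D) g := by
  classical
  intro W hW hne hWg
  rw [card_adjPairs_starContraction hTF hD]
  by_contra hlt
  -- Taking exactly |W| edges bounds the number of added vertices by |W|.
  obtain ⟨Q, hQ, hQc⟩ := Finset.exists_subset_card_eq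
    (show W.card ≤ (G.starEdges T F D φ W).card by omega)
  have hQ' := fun p (hp : p ∈ Q) => mem_starEdges.mp (hQ hp)
  have : Nonempty α := ⟨hne.choose⟩
  choose! v hv using fun p (hp : p ∈ Q) => (hQ' p hp).2.2.2
  have hTF' := Finset.disjoint_left.mp hTF
  set N := Q.image v \ W with hN
  have hdisj : Disjoint W N := Finset.disjoint_sdiff
  have hNc : N.card ≤ Q.card := (Finset.card_le_card Finset.sdiff_subset).trans
    Finset.card_image_le
  have hNmem : ∀ u ∈ N, u ∈ T ∧ φ u ∈ W ∧ u ∉ W := by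
    intro u hu
    obtain ⟨h1, h2⟩ := Finset.mem_sdiff.mp hu
    obtain ⟨p, hp, rfl⟩ := Finset.mem_image.mp h1
    refine ⟨(hv p hp).1, ?_, h2⟩
    rw [(hv p hp).2.1]; exact (hQ' p hp).1.1
  have hWN : W ∪ N ⊆ X := by
    refine Finset.union_subset (hW.trans (Finset.union_subset hFX (hD.trans hTX))) ?_
    exact fun u hu => hTX (hNmem u hu).1
  have hvWN : ∀ p ∈ Q, v p ∈ W ∪ N := by
    intro p hp
    by_cases h : v p ∈ W
    · exact Finset.mem_union_left _ h
    · exact Finset.mem_union_right _ (Finset.mem_sdiff.mpr ⟨Finset.mem_image_of_mem _ hp, h⟩)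
  have hcard := Finset.card_union_of_disjoint hdisj
  set S : Finset (α × α) := Q.image (fun p => (v p, p.2)) ∪ N.image (fun u => (u, φ u)) with hS
  have hSc : S.card = W.card + N.card := by
    rw [hS, Finset.card_union_of_disjoint, Finset.card_image_of_injOn,
      Finset.card_image_of_injOn, hQc]
    · intro a _ b _ hab
      exact congrArg Prod.fst hab
    · intro a ha b hb hab
      simp only [Prod.mk.injEq] at hab
      refine Prod.ext ?_ hab.2
      rw [← (hv a ha).2.1, ← (hv b hb).2.1, hab.1]
    · rw [Finset.disjoint_left]
      intro p hp hp'
      obtain ⟨q, hq, rfl⟩ := Finset.mem_image.mp hp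
      obtain ⟨u, hu, hup⟩ := Finset.mem_image.mp hp'
      have h1 := (hQ' q hq).2.2.1
      have h2 : φ u = q.2 := congrArg Prod.snd hup
      exact hTF' (hD (hφ u (hNmem u hu).1).1) (h2 ▸ h1)
  have hfst : ∀ p ∈ S, p.1 ∈ T := by
    intro p hp
    rcases Finset.mem_union.mp hp with h | h
    · obtain ⟨q, hq, rfl⟩ := Finset.mem_image.mp h
      exact (hv q hq).1
    · obtain ⟨u, hu, rfl⟩ := Finset.mem_image.mp h
      exact (hNmem u hu).1
  have hmain : 2 * S.card ≤ (G.adjPairs (W ∪ N)).card := by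
    refine two_mul_card_le_card_adjPairs _ ?_ ?_
    · intro p hp
      rw [mem_adjPairs]
      rcases Finset.mem_union.mp hp with h | h
      · obtain ⟨q, hq, rfl⟩ := Finset.mem_image.mp h
        exact ⟨⟨hvWN q hq, Finset.mem_union_left _ (hQ' q hq).1.2⟩, (hv q hq).2.2⟩
      · obtain ⟨u, hu, rfl⟩ := Finset.mem_image.mp h
        obtain ⟨h1, h2, h3⟩ := hNmem u hu
        refine ⟨⟨Finset.mem_union_right _ hu, Finset.mem_union_left _ h2⟩, ?_⟩
        rcases (hφ u h1).2 with h | h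
        · exact absurd (h ▸ h2) h3
        · exact h
    · intro p hp hp'
      have h1 := hfst _ hp'
      rcases Finset.mem_union.mp hp with h | h
      · obtain ⟨q, hq, rfl⟩ := Finset.mem_image.mp h
        exact hTF' h1 (hQ' q hq).2.2.1
      · obtain ⟨u, hu, rfl⟩ := Finset.mem_image.mp h
        rcases Finset.mem_union.mp hp' with h' | h'
        · obtain ⟨q, hq, hqu⟩ := Finset.mem_image.mp h'
          have h2 : q.2 = u := congrArg Prod.snd hqu
          exact hTF' (hNmem u hu).1 (h2 ▸ (hQ' q hq).2.2.1)
        · obtain ⟨w, hw, hwu⟩ := Finset.mem_image.mp h'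
          have h2 : w = φ u := congrArg Prod.fst hwu
          exact (hNmem w hw).2.2 (h2 ▸ (hNmem u hu).2.1)
  have := H (W ∪ N) hWN (hne.mono Finset.subset_union_left) (by omega)
  omega

/-- Contraction identifies no two edges between T and F: two vertices of one fibre with a common
neighbour in F would form a triangle, or a 4-cycle with the centre of the fibre. -/
lemma sum_nbrs_le_card_starEdges {X : Finset α} (H : G.LocallySparse X 4)
    (hTX : T ⊆ X) (hFX : F ⊆ X) (hTF : Disjoint T F)
    (hφ : ∀ v ∈ T, φ v ∈ D ∧ (φ v = v ∨ G.Adj v (φ v))) (hD : ∀ c ∈ D, c ∈ T ∧ φ c = c) :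
    ∑ v ∈ T, (G.nbrs F v).card ≤ (G.starEdges T F D φ (F ∪ D)).card := by
  have hTF' := Finset.disjoint_left.mp hTF
  rw [← Finset.card_sigma]
  refine Finset.card_le_card_of_injOn (fun q => (φ q.1, q.2)) ?_ ?_
  · rintro ⟨v, f⟩ hq
    simp only [Finset.mem_coe, Finset.mem_sigma, mem_nbrs] at hq
    obtain ⟨hv, hf, hvf⟩ := hq
    exact mem_starEdges.mpr ⟨⟨Finset.mem_union_right _ (hφ v hv).1, Finset.mem_union_left _ hf⟩,
      (hφ v hv).1, hf, v, hv, rfl, hvf⟩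
  · rintro ⟨v, f⟩ hq ⟨w, e⟩ hq' heq
    simp only [Finset.mem_coe, Finset.mem_sigma, mem_nbrs] at hq hq'
    simp only [Prod.mk.injEq] at heq
    obtain ⟨hφe, rfl⟩ := heq
    obtain ⟨hv, hf, hvf⟩ := hq
    obtain ⟨hw, -, hwf⟩ := hq'
    suffices v = w by subst this; rfl
    by_contra hne
    have key : ∀ a b : α, a ∈ T → b ∈ T → a ≠ b → G.Adj a f → G.Adj b f → G.Adj a b → False := by
      intro a b ha hb hab haf hbf hadj
      have hc : ({a, b, f} : Finset α).card = 3 := by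
        rw [Finset.card_eq_three]
        exact ⟨a, b, f, hab, haf.ne, hbf.ne, rfl⟩
      have h1 := H {a, b, f} (by
        intro z hz
        simp only [Finset.mem_insert, Finset.mem_singleton] at hz
        rcases hz with rfl | rfl | rfl
        exacts [hTX ha, hTX hb, hFX hf]) ⟨a, by simp⟩ (by omega)
      have h2 := G.card_adjPairs_insert (W := {b, f}) (v := a) (by
        simp [hab, haf.ne])
      have h3 := G.card_adjPairs_insert (W := {f}) (v := b) (by simp [hbf.ne])
      have h4 : ({b, f} : Finset α) ⊆ G.nbrs {b, f} a := by
        intro z hz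
        rw [mem_nbrs]
        refine ⟨hz, ?_⟩
        simp only [Finset.mem_insert, Finset.mem_singleton] at hz
        rcases hz with rfl | rfl
        exacts [hadj, haf]
      have h5 : ({f} : Finset α) ⊆ G.nbrs {f} b := by
        intro z hz
        rw [mem_nbrs]
        obtain rfl := Finset.mem_singleton.mp hz
        exact ⟨hz, hbf⟩
      have h6 := Finset.card_le_card h4
      have h7 := Finset.card_le_card h5
      rw [Finset.card_pair hbf.ne] at h6
      rw [Finset.card_singleton] at h7
      omega
    obtain ⟨hcD, hv'⟩ := hφ v hv
    obtain ⟨-, hw'⟩ := hφ w hw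
    have hcT := (hD _ hcD).1
    rw [← hφe] at hw'
    rcases hv' with hv' | hv'
    · rcases hw' with hw' | hw'
      · exact hne (hv'.symm.trans hw')
      · rw [hv'] at hw'
        exact key v w hv hw hne hvf hwf hw'.symm
    · rcases hw' with hw' | hw'
      · rw [hw'] at hv'
        exact key v w hv hw hne hvf hwf hv'
      · generalize φ v = c at *
        have hcf : c ≠ f := fun h => hTF' hcT (h ▸ hf)
        have h0 := H {v, w, c, f} (by
          intro z hz
          simp only [Finset.mem_insert, Finset.mem_singleton] at hz
          rcases hz with rfl | rfl | rfl | rfl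
          exacts [hTX hv, hTX hw, hTX hcT, hFX hf]) ⟨v, by simp⟩ Finset.card_le_four
        have hwn : w ∉ ({c, f} : Finset α) := by simp [hw'.ne, hwf.ne]
        have hvn : v ∉ ({w, c, f} : Finset α) := by simp [hne, hv'.ne, hvf.ne]
        have h2 := G.card_adjPairs_insert hvn
        have h3 := G.card_adjPairs_insert hwn
        rw [Finset.card_insert_of_notMem hvn, Finset.card_insert_of_notMem hwn,
          Finset.card_pair hcf] at h0
        have h4 : ({c, f} : Finset α) ⊆ G.nbrs {w, c, f} v := by
          intro z hz
          rw [mem_nbrs]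
          refine ⟨Finset.mem_insert_of_mem hz, ?_⟩
          simp only [Finset.mem_insert, Finset.mem_singleton] at hz
          rcases hz with rfl | rfl
          exacts [hv', hvf]
        have h5 : ({c, f} : Finset α) ⊆ G.nbrs {c, f} w := by
          intro z hz
          rw [mem_nbrs]
          refine ⟨hz, ?_⟩
          simp only [Finset.mem_insert, Finset.mem_singleton] at hz
          rcases hz with rfl | rfl
          exacts [hw', hwf]
        have h6 := Finset.card_le_card h4
        have h7 := Finset.card_le_card h5
        rw [Finset.card_pair hcf] at h6 h7
        omega

end Star

/-- If a graph of minimum degree three without short cycles is the union of a forest and a set `F`,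
then either the forest has few vertices in terms of `F`, or `F` is large. -/
theorem LocallySparse.pow_le_card_of_forest {G : SimpleGraph α} {X F : Finset α} {h : ℕ} {x : ℝ}
    (hs : G.LocallySparse X (8 * h)) (hh : 1 ≤ h) (hx : 0 ≤ x) (hF : F ⊆ X)
    (hforest : G.LocallySparse (X \ F) (X \ F).card)
    (hdeg : ∀ v ∈ X, 3 ≤ (G.nbrs X v).card)
    (hlt : 2 * (1 + x) * F.card < (X \ F).card) : x ^ h ≤ F.card := by
  classical
  set T := X \ F with hT
  have hTX : T ⊆ X := Finset.sdiff_subset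
  have hTF : Disjoint T F := Finset.sdiff_disjoint
  obtain ⟨D, hDT, hdom, hDc⟩ := G.exists_dominating_card_le T
  have hN := card_add_isolated_le_sum_nbrs (F := F) hforest (by
    intro v hv
    refine (hdeg v (hTX hv)).trans ((Finset.card_le_card ?_).trans (Finset.card_union_le _ _))
    intro w hw
    rw [Finset.mem_union, mem_nbrs, mem_nbrs]
    rw [mem_nbrs] at hw
    by_cases hwF : w ∈ F
    · exact Or.inr ⟨hwF, hw.2⟩
    · exact Or.inl ⟨Finset.mem_sdiff.mpr ⟨hw.1, hwF⟩, hw.2⟩)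
  choose! ψ hψ using hdom
  let φ : α → α := fun v => if v ∈ D then v else ψ v
  have hφ : ∀ v ∈ T, φ v ∈ D ∧ (φ v = v ∨ G.Adj v (φ v)) := by
    intro v hv
    by_cases h : v ∈ D
    · simp [φ, h]
    · simp only [φ, h, if_false]
      exact ⟨(hψ v hv h).1, Or.inr (hψ v hv h).2⟩
  have hφD : ∀ c ∈ D, c ∈ T ∧ φ c = c := fun c hc => ⟨hDT hc, by simp [φ, hc]⟩
  have hE := sum_nbrs_le_card_starEdges (hs.mono subset_rfl (by omega)) hTX hF hTF hφ hφD
  -- Halving 8h leaves 4h, which is what 2h levels of search require.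
  have hB : (G.starContraction T F D φ).LocallySparse (F ∪ D) (2 * (2 * h)) :=
    LocallySparse.starContraction (hs.mono subset_rfl (by omega)) hTX hF hTF hDT hφ
  set B := G.starContraction T F D φ with hBdef
  have hP := card_adjPairs_starContraction (G := G) (φ := φ) hTF hDT (F ∪ D)
  have hFD : Disjoint F D := (hTF.mono_left hDT).symm
  have hadjF : ∀ a b, B.Adj a b → a ∈ F → b ∈ D := by
    rintro a b ⟨-, ⟨h1, -⟩ | ⟨h1, -⟩⟩ ha
    · exact absurd h1 (Finset.disjoint_left.mp hFD ha)
    · exact h1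
  have hadjD : ∀ a b, B.Adj a b → a ∈ D → b ∈ F := by
    rintro a b ⟨-, ⟨-, h1, -⟩ | ⟨-, h1, -⟩⟩ ha
    · exact h1
    · exact absurd ha (Finset.disjoint_left.mp hFD h1)
  let wt : α → ℝ := fun v => if v ∈ F then 1 + x else 1
  have hwt : ∑ v ∈ F ∪ D, wt v = (1 + x) * F.card + D.card := by
    rw [Finset.sum_union hFD, Finset.sum_congr rfl (g := fun _ => 1 + x)
      (fun v hv => by simp [wt, hv]), Finset.sum_congr rfl (s₁ := D) (g := fun _ => (1 : ℝ))
      (fun v hv => by simp [wt, Finset.disjoint_right.mp hFD hv])]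
    simp only [Finset.sum_const, nsmul_eq_mul, mul_one]
    ring
  -- With i isolated vertices, 2(1+x)|F| + 2|D| < |T| + (|T| + i) ≤ 2(|T| + 2i).
  obtain ⟨Z, hZ, hZne, hZdeg⟩ := exists_subset_weight_lt_card_nbrs (G := B) wt (F ∪ D) (by
    rw [hwt, hP]
    have h1 : (T.card : ℝ) + 2 * (G.isolated T).card
        ≤ (G.starEdges T F D φ (F ∪ D)).card := by exact_mod_cast hN.trans hE
    have h2 : 2 * (D.card : ℝ) ≤ T.card + (G.isolated T).card := by exact_mod_cast hDc
    have h3 : (0 : ℝ) ≤ (G.isolated T).card := Nat.cast_nonneg _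
    push_cast
    linarith)
  have hpos : ∀ v, 0 ≤ wt v := by
    intro v
    simp only [wt]; split_ifs <;> linarith
  -- Rooting the search in F puts the even levels in F and the odd ones in D.
  obtain ⟨r, hrZ, hrF⟩ : ∃ r ∈ Z, r ∈ F := by
    obtain ⟨v, hv⟩ := hZne
    rcases Finset.mem_union.mp (hZ hv) with h | h
    · exact ⟨v, hv, h⟩
    · have hp : (0 : ℝ) < (B.nbrs Z v).card := (hpos v).trans_lt (hZdeg v hv)
      obtain ⟨w, hw⟩ := Finset.card_pos.mp (by exact_mod_cast hp)
      rw [mem_nbrs] at hw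
      exact ⟨w, hw.1, hadjD v w hw.2 h⟩
  obtain ⟨L, h0, hLZ, hLadj, hL⟩ := (hB.mono hZ le_rfl).exists_levels hrZ
  have hlev : ∀ i, L (2 * i) ⊆ F ∧ L (2 * i + 1) ⊆ D := by
    intro i
    have step : ∀ i, L (2 * i) ⊆ F → L (2 * i + 1) ⊆ D := by
      intro i hi v hv
      obtain ⟨u, hu, huv⟩ := hLadj _ v hv
      exact hadjF u v huv (hi hu)
    induction i with
    | zero =>
      have : L (2 * 0) ⊆ F := by simpa [h0] using hrF
      exact ⟨this, step 0 this⟩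
    | succ i ih =>
      have : L (2 * (i + 1)) ⊆ F := by
        intro v hv
        obtain ⟨u, hu, huv⟩ := hLadj (2 * i + 1) v hv
        exact hadjD u v huv (ih.2 hu)
      exact ⟨this, step _ this⟩
  have hgrow : ∀ i < 2 * h, ∀ y : ℝ, (∀ v ∈ L i, y ≤ (B.nbrs Z v).card) →
      (y - 1) * (L i).card ≤ (L (i + 1)).card := by
    intro i hi y hy
    have h1 : (∑ v ∈ L i, ((B.nbrs Z v).card : ℝ)) ≤ (L (i + 1)).card + (L i).card := by
      exact_mod_cast hL i hi
    have h2 := Finset.card_nsmul_le_sum (L i) (fun v => ((B.nbrs Z v).card : ℝ)) y hy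
    rw [nsmul_eq_mul] at h2
    linarith
  have hpow : ∀ i ≤ h, x ^ i ≤ (L (2 * i)).card := by
    intro i
    induction i with
    | zero => simp [h0]
    | succ i ih =>
      intro hi
      have h1 := ih (by omega)
      have h2 := hgrow (2 * i) (by omega) (1 + x) fun v hv => by
        have := hZdeg v (hLZ _ hv)
        simp only [wt, (hlev i).1 hv, if_true] at this
        exact this.le
      -- A degree above 1 is at least 2, so the step from D to F does not shrink the level.
      have h3 := hgrow (2 * i + 1) (by omega) 2 fun v hv => by
        have := hZdeg v (hLZ _ hv)
        simp only [wt, Finset.disjoint_right.mp hFD ((hlev i).2 hv), if_false] at this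
        have h4 : 1 < (B.nbrs Z v).card := by exact_mod_cast this
        exact_mod_cast h4
      rw [pow_succ]
      have h5 : 2 * (i + 1) = 2 * i + 1 + 1 := by ring
      rw [h5]
      nlinarith
  refine (hpow h le_rfl).trans ?_
  exact_mod_cast Finset.card_le_card (hlev h).1

end SimpleGraph

/-! ### Cycles and dense sets in multigraphs -/

theorem SimpleGraph.IsAcyclic.card_edgeFinset_lt {W : Type*} [Fintype W] [Nonempty W]
    {H : SimpleGraph W} [Fintype H.edgeSet] (h : H.IsAcyclic) :
    H.edgeFinset.card < Fintype.card W := by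
  classical
  obtain ⟨T, hHT, hT⟩ := exists_maximal_isAcyclic_of_le_isAcyclic (G := ⊤) le_top h
  have hT' : T.IsTree := by
    rw [← maximal_isAcyclic_iff_isTree]
    simpa using hT
  have h1 := hT'.card_edgeFinset
  have h2 : H.edgeFinset.card ≤ T.edgeFinset.card :=
    Finset.card_le_card (edgeFinset_mono hHT)
  omega

namespace MultiGraph

variable {V : Type u}

open Classical in
/-- The edges of `G` with both ends in `U`. -/
noncomputable def edgesIn (G : MultiGraph V) (U : Finset V) : Multiset (Sym2 V) :=
  G.edges.filter fun e => ∀ v ∈ e, v ∈ U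

/-- `U` spans at least as many edges as it has vertices. -/
def Dense (G : MultiGraph V) (U : Finset V) : Prop :=
  U ⊆ G.verts ∧ U.Nonempty ∧ U.card ≤ (G.edgesIn U).card

/-- The underlying simple graph. -/
def toSimple (G : MultiGraph V) : SimpleGraph V where
  Adj a b := a ≠ b ∧ s(a, b) ∈ G.edges
  symm := ⟨fun a b h => ⟨h.1.symm, Sym2.eq_swap (a := a) (b := b) ▸ h.2⟩⟩
  loopless := ⟨fun _ h => h.1 rfl⟩

lemma mem_edgesIn {G : MultiGraph V} {U : Finset V} {e : Sym2 V} :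
    e ∈ G.edgesIn U ↔ e ∈ G.edges ∧ ∀ v ∈ e, v ∈ U := by
  simp [edgesIn]

lemma edgesIn_le (G : MultiGraph V) (U : Finset V) : G.edgesIn U ≤ G.edges := by
  classical exact Multiset.filter_le _ _

lemma le_edgesIn {G : MultiGraph V} {U : Finset V} {s : Multiset (Sym2 V)} (hs : s ≤ G.edges)
    (hU : ∀ e ∈ s, ∀ v ∈ e, v ∈ U) : s ≤ G.edgesIn U := by
  classical exact Multiset.le_filter.mpr ⟨hs, hU⟩

lemma card_cycleEdges (C : List V) : (cycleEdges C).card = C.length := by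
  simp [cycleEdges]

lemma mem_of_mem_cycleEdges {C : List V} {e : Sym2 V} (he : e ∈ cycleEdges C) {v : V}
    (hv : v ∈ e) : v ∈ C := by
  rw [cycleEdges, Multiset.mem_coe, List.mem_iff_getElem] at he
  obtain ⟨i, hi, rfl⟩ := he
  rw [List.getElem_zipWith, Sym2.mem_iff] at hv
  rcases hv with rfl | rfl
  · exact List.getElem_mem _
  · exact List.mem_rotate.mp (List.getElem_mem _)

lemma exists_mem_cycleEdges {C : List V} {v : V} (hv : v ∈ C) : ∃ e ∈ cycleEdges C, v ∈ e := by
  obtain ⟨i, hi, rfl⟩ := List.mem_iff_getElem.mp hv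
  refine ⟨s(C[i], (C.rotate 1)[i]'(by simpa using hi)), ?_, by simp⟩
  rw [cycleEdges, Multiset.mem_coe, List.mem_iff_getElem]
  exact ⟨i, by simpa using hi, by simp⟩

/-- The support of a closed walk lists its base point at both ends, hence `dropLast`. -/
lemma isCycle_of_walk {G : MultiGraph V} {u : V} {p : G.toSimple.Walk u u} (hp : p.IsCycle) :
    G.IsCycle p.support.dropLast := by
  refine ⟨?_, hp.nodup_dropLast_support, ?_⟩
  · intro h
    have h1 := congrArg List.length h
    have h2 := hp.three_le_length
    rw [List.length_dropLast, SimpleGraph.Walk.length_support, List.length_nil] at h1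
    omega
  · have hedges : cycleEdges p.support.dropLast = (p.edges : Multiset (Sym2 V)) := by
      rw [cycleEdges, SimpleGraph.Walk.edges_eq_zipWith_support, Multiset.coe_eq_coe]
      refine List.Perm.of_eq ?_
      cases p with
      | nil => exact absurd rfl hp.ne_nil
      | cons h q =>
        have hq := q.dropLast_support_concat
        have hc : (SimpleGraph.Walk.cons h q).support.dropLast = u :: q.support.dropLast := by
          rw [SimpleGraph.Walk.support_cons, List.dropLast_cons_of_ne_nil q.support_ne_nil]
        rw [hc, List.rotate_cons_succ, List.rotate_zero, hq, SimpleGraph.Walk.support_cons,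
          List.tail_cons]
        conv_rhs => rw [← hq]
        rw [← List.cons_append]
        conv_lhs => rw [← hq]
        have hl : (u :: q.support.dropLast).length = (q.support.dropLast ++ [u]).length := by simp
        rw [← List.append_nil (q.support.dropLast ++ [u]), List.zipWith_append hl]
        simp
    rw [hedges, Multiset.le_iff_subset (Multiset.coe_nodup.mpr hp.edges_nodup)]
    intro e he
    have he' := p.edges_subset_edgeSet (Multiset.mem_coe.mp he)
    induction e using Sym2.ind with
    | _ a b => exact ((SimpleGraph.mem_edgeSet _).mp he').2

variable [DecidableEq V]

lemma IsCycle.dense {G : MultiGraph V} {C : List V} (h : G.IsCycle C) : G.Dense C.toFinset := by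
  obtain ⟨h1, h2, h3⟩ := h
  refine ⟨?_, ?_, ?_⟩
  · intro v hv
    obtain ⟨e, he, hve⟩ := exists_mem_cycleEdges (List.mem_toFinset.mp hv)
    exact G.mem_verts e (Multiset.mem_of_le h3 he) v hve
  · exact List.toFinset_nonempty_iff _ |>.mpr h1
  · rw [List.toFinset_card_of_nodup h2, ← card_cycleEdges C]
    refine Multiset.card_le_card (le_edgesIn h3 fun e he v hv => ?_)
    exact List.mem_toFinset.mpr (mem_of_mem_cycleEdges he hv)

/-- A set of vertices that spans at least as many edges as it has vertices contains a cycle. -/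
theorem Dense.exists_isCycle {G : MultiGraph V} {U : Finset V} (h : G.Dense U) :
    ∃ C : List V, G.IsCycle C ∧ C.toFinset ⊆ U := by
  classical
  obtain ⟨-, hne, hcard⟩ := h
  by_cases hloop : ∃ a ∈ U, s(a, a) ∈ G.edges
  · obtain ⟨a, ha, hae⟩ := hloop
    refine ⟨[a], ⟨by simp, by simp, ?_⟩, by simpa using ha⟩
    simpa [cycleEdges] using hae
  by_cases hnd : (G.edgesIn U).Nodup
  · have : Nonempty U := hne.to_subtype
    set H : SimpleGraph U := G.toSimple.induce (U : Set V) with hH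
    have hcard' : (G.edgesIn U).card ≤ H.edgeFinset.card := by
      rw [← Multiset.toFinset_card_of_nodup hnd]
      refine (Finset.card_le_card (t := H.edgeFinset.image (Sym2.map Subtype.val)) ?_).trans
        Finset.card_image_le
      intro e he
      rw [Multiset.mem_toFinset, mem_edgesIn] at he
      induction e using Sym2.ind with
      | _ a b =>
        have ha : a ∈ U := he.2 a (by simp)
        have hb : b ∈ U := he.2 b (by simp)
        refine Finset.mem_image.mpr ⟨s(⟨a, ha⟩, ⟨b, hb⟩), ?_, rfl⟩
        rw [SimpleGraph.mem_edgeFinset, SimpleGraph.mem_edgeSet]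
        refine ⟨?_, he.1⟩
        rintro rfl
        exact hloop ⟨a, ha, he.1⟩
    have hnac : ¬ H.IsAcyclic := by
      intro hac
      have := hac.card_edgeFinset_lt
      rw [Fintype.card_coe] at this
      omega
    rw [SimpleGraph.IsAcyclic] at hnac
    push Not at hnac
    obtain ⟨u, p, hp⟩ := hnac
    let f := (SimpleGraph.Embedding.induce (G := G.toSimple) (U : Set V)).toHom
    have hf : Function.Injective f := Subtype.val_injective
    refine ⟨_, isCycle_of_walk (hp.map hf), ?_⟩
    intro v hv
    have hv' := List.mem_of_mem_dropLast (List.mem_toFinset.mp hv)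
    rw [SimpleGraph.Walk.support_map, List.mem_map] at hv'
    obtain ⟨w, -, rfl⟩ := hv'
    exact w.2
  · rw [Multiset.nodup_iff_count_le_one] at hnd
    push Not at hnd
    obtain ⟨e, he⟩ := hnd
    have hmem := mem_edgesIn.mp (Multiset.count_pos.mp (by omega : 0 < (G.edgesIn U).count e))
    induction e using Sym2.ind with
    | _ a b =>
      have ha : a ∈ U := hmem.2 a (by simp)
      have hb : b ∈ U := hmem.2 b (by simp)
      have hab : a ≠ b := by
        rintro rfl
        exact hloop ⟨a, ha, hmem.1⟩
      refine ⟨[a, b], ⟨by simp, by simp [hab], ?_⟩, ?_⟩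
      · have : cycleEdges [a, b] = Multiset.replicate 2 s(a, b) := by
          simp [cycleEdges, Multiset.replicate_succ, Sym2.eq_swap (a := b) (b := a)]
          rfl
        rw [this, ← Multiset.le_count_iff_replicate_le]
        exact le_trans he (Multiset.count_le_of_le _ (G.edgesIn_le U))
      · intro v hv
        simp only [List.toFinset_cons, List.toFinset_nil, insert_empty_eq, Finset.mem_insert,
          Finset.mem_singleton] at hv
        rcases hv with rfl | rfl
        exacts [ha, hb]

lemma card_adjPairs_toSimple_le (G : MultiGraph V) (W : Finset V) :
    (G.toSimple.adjPairs W).card ≤ 2 * (G.edgesIn W).card := by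
  classical
  refine (Finset.card_le_mul_card_image (f := fun p : V × V => s(p.1, p.2)) _ 2 ?_).trans
    (Nat.mul_le_mul_left 2 ((Finset.card_le_card ?_).trans (Multiset.toFinset_card_le _)))
  · intro e _
    induction e using Sym2.ind with
    | _ a b =>
      refine (Finset.card_le_card (t := {(a, b), (b, a)}) ?_).trans Finset.card_le_two
      rintro ⟨c, d⟩ hp
      simpa using (Finset.mem_filter.mp hp).2
  · intro e he
    obtain ⟨p, hp, rfl⟩ := Finset.mem_image.mp he
    rw [SimpleGraph.mem_adjPairs] at hp
    rw [Multiset.mem_toFinset, mem_edgesIn]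
    refine ⟨hp.2.2, fun v hv => ?_⟩
    rcases Sym2.mem_iff.mp hv with rfl | rfl
    exacts [hp.1.1, hp.1.2]

lemma locallySparse_toSimple {G : MultiGraph V} {X : Finset V} {g : ℕ} (hX : X ⊆ G.verts)
    (h : ∀ U ⊆ X, G.Dense U → g < U.card) : G.toSimple.LocallySparse X g := by
  intro W hW hne hc
  have h1 := G.card_adjPairs_toSimple_le W
  have h2 : ¬ G.Dense W := fun hd => absurd (h W hW hd) (by omega)
  have h3 : (G.edgesIn W).card < W.card := by
    by_contra h3
    exact h2 ⟨hW.trans hX, hne, by omega⟩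
  omega

/-! ### Irreducible multigraphs -/

/-- No reduction rule applies to `R`. -/
def Irreducible (R : MultiGraph V) : Prop := ∀ R' : MultiGraph V, ¬ ReductionStep R R'

/-- An irreducible multigraph without loops and parallel edges has minimum degree three. -/
lemma Irreducible.three_le_card_nbrs {R : MultiGraph V} (hR : R.Irreducible)
    (h : ∀ U, R.Dense U → 2 < U.card) {v : V} (hv : v ∈ R.verts) :
    3 ≤ (R.toSimple.nbrs R.verts v).card := by
  have hloop : ∀ a, s(a, a) ∉ R.edges := by
    intro a ha
    have haV := R.mem_verts _ ha a (by simp)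
    have := h {a} ⟨by simpa using haV, by simp, by
      rw [Finset.card_singleton]
      exact Multiset.card_pos_iff_exists_mem.mpr ⟨_, mem_edgesIn.mpr ⟨ha, by simp⟩⟩⟩
    simp at this
  have hnd : R.edges.Nodup := by
    rw [Multiset.nodup_iff_count_le_one]
    intro e
    by_contra hc
    have hmem : e ∈ R.edges := Multiset.count_pos.mp (by omega)
    have hrep : Multiset.replicate 2 e ≤ R.edges := Multiset.le_count_iff_replicate_le.mp (by omega)
    induction e using Sym2.ind with
    | _ a b =>
      have ha := R.mem_verts _ hmem a (by simp)
      have hb := R.mem_verts _ hmem b (by simp)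
      have hcard : ({a, b} : Finset V).card ≤ 2 := Finset.card_le_two
      have := h {a, b} ⟨?_, by simp, ?_⟩
      · omega
      · intro z hz
        simp only [Finset.mem_insert, Finset.mem_singleton] at hz
        rcases hz with rfl | rfl
        exacts [ha, hb]
      · refine hcard.trans ?_
        have := Multiset.card_le_card (le_edgesIn (U := {a, b}) hrep (by
          intro e he v hv
          rw [Multiset.eq_of_mem_replicate he] at hv
          simpa using hv))
        simpa using this
  have hcount : R.edges.count s(v, v) = 0 := Multiset.count_eq_zero.mpr (hloop v)
  have hdeg : R.degree v = (R.edges.filter (fun e => v ∈ e)).card := by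
    rw [degree, hcount, add_zero]
  have h1 : ¬ R.degree v ≤ 1 := fun hd => hR _ (.deleteLeaf v hv hd rfl)
  have h2 : R.degree v ≠ 2 := by
    intro hd
    obtain ⟨e, e', hee⟩ := Multiset.card_eq_two.mp (hdeg ▸ hd)
    have he : e ∈ R.edges.filter (fun e => v ∈ e) := by rw [hee]; simp
    have he' : e' ∈ R.edges.filter (fun e => v ∈ e) := by rw [hee]; simp
    rw [Multiset.mem_filter] at he he'
    obtain ⟨x, rfl⟩ := Sym2.mem_iff_exists.mp he.2
    obtain ⟨y, rfl⟩ := Sym2.mem_iff_exists.mp he'.2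
    have hx : x ∈ R.verts \ {v} := by
      rw [Finset.mem_sdiff, Finset.mem_singleton]
      refine ⟨R.mem_verts _ he.1 x (by simp), ?_⟩
      rintro rfl; exact hloop _ he.1
    have hy : y ∈ R.verts \ {v} := by
      rw [Finset.mem_sdiff, Finset.mem_singleton]
      refine ⟨R.mem_verts _ he'.1 y (by simp), ?_⟩
      rintro rfl; exact hloop _ he'.1
    refine hR ⟨R.verts \ {v}, s(x, y) ::ₘ (R.deleteVerts {v}).edges, ?_⟩
      (.bypass v x y hv hd (hloop v) hee rfl rfl)
    intro e he w hw
    rcases Multiset.mem_cons.mp he with rfl | he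
    · rcases Sym2.mem_iff.mp hw with rfl | rfl
      exacts [hx, hy]
    · exact (R.deleteVerts {v}).mem_verts e he w hw
  have h3 : 3 ≤ (R.edges.filter (fun e => v ∈ e)).card := by omega
  rw [← Multiset.toFinset_card_of_nodup (hnd.filter _)] at h3
  refine h3.trans ((Finset.card_le_card
    (t := (R.toSimple.nbrs R.verts v).image fun w => s(v, w)) ?_).trans Finset.card_image_le)
  intro e he
  rw [Multiset.mem_toFinset, Multiset.mem_filter] at he
  obtain ⟨w, rfl⟩ := Sym2.mem_iff_exists.mp he.2
  refine Finset.mem_image_of_mem _ ((SimpleGraph.mem_nbrs _).mpr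
    ⟨R.mem_verts _ he.1 w (by simp), ?_, he.1⟩)
  rintro rfl; exact hloop _ he.1

/-! ### Dense sets and hitting sets under the reduction rules -/

/-- `F` meets every dense set, and hence every cycle. -/
def Hits (G : MultiGraph V) (F : Finset V) : Prop :=
  ∀ U, G.Dense U → ¬ Disjoint U F

lemma edgesIn_deleteVerts {G : MultiGraph V} {S U : Finset V} (h : Disjoint U S) :
    (G.deleteVerts S).edgesIn U = G.edgesIn U := by
  classical
  unfold edgesIn deleteVerts
  rw [Multiset.filter_filter]
  refine Multiset.filter_congr fun e _ => ⟨fun h => h.1, fun he => ⟨he, fun v hv hve => ?_⟩⟩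
  exact Finset.disjoint_left.mp h (he v hve) hv

lemma dense_deleteVerts {G : MultiGraph V} {S U : Finset V} :
    (G.deleteVerts S).Dense U ↔ G.Dense U ∧ Disjoint U S := by
  constructor
  · rintro ⟨h1, h2, h3⟩
    have hd : Disjoint U S := Finset.disjoint_left.mpr fun v hv => (Finset.mem_sdiff.mp (h1 hv)).2
    exact ⟨⟨h1.trans Finset.sdiff_subset, h2, edgesIn_deleteVerts hd ▸ h3⟩, hd⟩
  · rintro ⟨⟨h1, h2, h3⟩, hd⟩
    refine ⟨fun v hv => Finset.mem_sdiff.mpr ⟨h1 hv, Finset.disjoint_left.mp hd hv⟩, h2, ?_⟩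
    rwa [edgesIn_deleteVerts hd]

open Classical in
lemma edgesIn_insert {G : MultiGraph V} {U : Finset V} {v : V} (hv : v ∉ U) :
    G.edgesIn (insert v U) = G.edgesIn U +
      (G.edges.filter (fun e => v ∈ e)).filter fun e => ∀ w ∈ e, w ∈ insert v U := by
  rw [← Multiset.filter_add_not (fun e => v ∈ e) (G.edgesIn (insert v U)), add_comm]
  congr 1
  · unfold edgesIn
    rw [Multiset.filter_filter]
    refine Multiset.filter_congr fun e _ => ?_
    constructor
    · rintro ⟨h1, h2⟩ w hw
      rcases Finset.mem_insert.mp (h2 w hw) with rfl | h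
      · exact absurd hw h1
      · exact h
    · exact fun h => ⟨fun hve => hv (h v hve), fun w hw => Finset.mem_insert_of_mem (h w hw)⟩
  · unfold edgesIn
    rw [Multiset.filter_filter, Multiset.filter_filter]
    refine Multiset.filter_congr fun e _ => and_comm

lemma card_edgesIn_le_erase {G : MultiGraph V} {U : Finset V} {v : V} (hv : v ∈ U) :
    (G.edgesIn U).card ≤
      (G.edgesIn (U.erase v)).card + (G.edges.filter (fun e => v ∈ e)).card := by
  classical
  conv_lhs => rw [← Finset.insert_erase hv, edgesIn_insert (Finset.notMem_erase v U)]
  rw [Multiset.card_add]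
  exact Nat.add_le_add_left (Multiset.card_le_card (Multiset.filter_le _ _)) _

section Bypass

variable {G G' : MultiGraph V} {v x y : V}

lemma ne_of_bypass (hloop : s(v, v) ∉ G.edges)
    (hxy : G.edges.filter (fun e => v ∈ e) = {s(v, x), s(v, y)}) : x ≠ v ∧ y ≠ v := by
  have hx : s(v, x) ∈ G.edges.filter (fun e => v ∈ e) := by rw [hxy]; simp
  have hy : s(v, y) ∈ G.edges.filter (fun e => v ∈ e) := by rw [hxy]; simp
  rw [Multiset.mem_filter] at hx hy
  constructor
  · rintro rfl; exact hloop hx.1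
  · rintro rfl; exact hloop hy.1

lemma card_edgesIn_bypass {U : Finset V} (hv : v ∉ U)
    (hedges : G'.edges = s(x, y) ::ₘ (G.deleteVerts {v}).edges) :
    (G'.edgesIn U).card = (G.edgesIn U).card + if x ∈ U ∧ y ∈ U then 1 else 0 := by
  classical
  have h1 := edgesIn_deleteVerts (G := G) (S := {v}) (U := U) (by simpa using hv)
  rw [← h1]
  unfold edgesIn
  rw [hedges, Multiset.filter_cons, Multiset.card_add, add_comm]
  congr 1
  simp only [Sym2.mem_iff, forall_eq_or_imp, forall_eq]
  split_ifs <;> simp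

lemma card_edgesIn_insert_bypass {U : Finset V} (hv : v ∉ U) (hxv : x ≠ v) (hyv : y ≠ v)
    (hxy : G.edges.filter (fun e => v ∈ e) = {s(v, x), s(v, y)}) :
    (G.edgesIn (insert v U)).card = (G.edgesIn U).card + (if x ∈ U then 1 else 0) +
      if y ∈ U then 1 else 0 := by
  classical
  rw [edgesIn_insert hv, hxy, Multiset.card_add, add_assoc]
  congr 1
  rw [show ({s(v, x), s(v, y)} : Multiset (Sym2 V)) = s(v, x) ::ₘ {s(v, y)} from rfl,
    Multiset.filter_cons, Multiset.filter_singleton, Multiset.card_add]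
  simp only [Sym2.mem_iff, forall_eq_or_imp, forall_eq, Finset.mem_insert, true_or, true_and,
    hxv, hyv, false_or]
  congr 1 <;> split_ifs <;> simp

end Bypass

lemma Dense.of_trim {G G' : MultiGraph V} {e : Sym2 V} (he : 2 < G.edges.count e)
    (hverts : G'.verts = G.verts)
    (hedges : G'.edges = Multiset.replicate 2 e + G.edges.filter (fun e' => e' ≠ e))
    {U : Finset V} (h : G'.Dense U) : G.Dense U := by
  refine ⟨hverts ▸ h.1, h.2.1, h.2.2.trans (Multiset.card_le_card (le_edgesIn ?_ ?_))⟩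
  · refine (G'.edgesIn_le U).trans ?_
    rw [hedges]
    have h1 : Multiset.replicate 2 e ≤ G.edges.filter (fun e' => e' = e) := by
      rw [Multiset.filter_eq', Multiset.replicate_le_replicate]
      exact he.le
    exact (add_le_add_left h1 _).trans_eq (Multiset.filter_add_not _ _)
  · exact fun _ h => (mem_edgesIn.mp h).2

namespace ReductionStep

variable {G G' : MultiGraph V}

/-- Removing v from U costs one vertex and, on balance, at most one edge: a leaf has at most one,
and a bypassed vertex loses two but returns one when both neighbours are in U. If a trimmed edge
lies inside U, its ends with the two remaining copies are already dense. -/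
lemma exists_dense_subset (h : ReductionStep G G') {U : Finset V} (hU : G.Dense U) :
    ∃ U' ⊆ U, G'.Dense U' := by
  obtain ⟨h1, h2, h3⟩ := hU
  cases h with
  | deleteLeaf v hv hdeg h =>
    subst h
    by_cases hvU : v ∈ U
    · have hle := card_edgesIn_le_erase (G := G) hvU
      have hc := Finset.card_erase_add_one hvU
      unfold degree at hdeg
      refine ⟨U.erase v, Finset.erase_subset _ _, dense_deleteVerts.mpr
        ⟨⟨(Finset.erase_subset _ _).trans h1, ?_, by omega⟩, by simp⟩⟩
      by_contra hemp
      rw [Finset.not_nonempty_iff_eq_empty] at hemp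
      have hUv : ∀ w ∈ U, w = v := by
        intro w hw
        by_contra hwv
        exact Finset.notMem_empty w (hemp ▸ Finset.mem_erase.mpr ⟨hwv, hw⟩)
      obtain ⟨e, he⟩ := Multiset.card_pos_iff_exists_mem.mp
        ((Finset.card_pos.mpr h2).trans_le h3)
      rw [mem_edgesIn] at he
      have hev : e = s(v, v) := by
        induction e using Sym2.ind with
        | _ a b => rw [hUv a (he.2 a (by simp)), hUv b (he.2 b (by simp))]
      rw [hev] at he
      have h4 := Multiset.count_pos.mpr he.1
      have h5 : 0 < (G.edges.filter (fun e => v ∈ e)).card :=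
        Multiset.card_pos_iff_exists_mem.mpr ⟨_, Multiset.mem_filter.mpr ⟨he.1, by simp⟩⟩
      omega
    · exact ⟨U, subset_rfl, dense_deleteVerts.mpr ⟨⟨h1, h2, h3⟩, by simpa using hvU⟩⟩
  | bypass v x y hv hdeg hloop hxy hverts hedges =>
    obtain ⟨hxv, hyv⟩ := ne_of_bypass hloop hxy
    have hsub : U.erase v ⊆ G'.verts := by
      rw [hverts]
      intro w hw
      rw [Finset.mem_erase] at hw
      exact Finset.mem_sdiff.mpr ⟨h1 hw.2, by simpa using hw.1⟩
    have hb := card_edgesIn_bypass (Finset.notMem_erase v U) hedges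
    by_cases hvU : v ∈ U
    · have hi := card_edgesIn_insert_bypass (Finset.notMem_erase v U) hxv hyv hxy
      rw [Finset.insert_erase hvU] at hi
      have hc := Finset.card_erase_add_one hvU
      refine ⟨U.erase v, Finset.erase_subset _ _, hsub, ?_, ?_⟩
      · by_contra hemp
        rw [Finset.not_nonempty_iff_eq_empty] at hemp
        rw [hemp] at hi
        have : G.edgesIn ∅ = 0 := by
          rw [Multiset.eq_zero_iff_forall_notMem]
          intro e he
          induction e using Sym2.ind with
          | _ a b => exact Finset.notMem_empty a ((mem_edgesIn.mp he).2 a (by simp))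
        rw [this] at hi
        have := Finset.card_pos.mpr h2
        simp at hi
        rw [hi] at h3
        simp at h3
        simp [h3] at this
      · rw [hb]
        by_cases hx : x ∈ U.erase v <;> by_cases hy : y ∈ U.erase v <;> simp [hx, hy] at hi ⊢ <;>
          omega
    · rw [Finset.erase_eq_of_notMem hvU] at hb hsub
      exact ⟨U, subset_rfl, hsub, h2, by omega⟩
  | trim e he hverts hedges =>
    by_cases heU : ∀ v ∈ e, v ∈ U
    · induction e using Sym2.ind with
      | _ a b =>
        have hsub : ({a, b} : Finset V) ⊆ U := by
          intro z hz
          simp only [Finset.mem_insert, Finset.mem_singleton] at hz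
          rcases hz with rfl | rfl
          exacts [heU _ (by simp), heU _ (by simp)]
        refine ⟨{a, b}, hsub, hverts ▸ hsub.trans h1, by simp, Finset.card_le_two.trans ?_⟩
        have hle : Multiset.replicate 2 s(a, b) ≤ G'.edgesIn {a, b} := by
          refine le_edgesIn (hedges ▸ Multiset.le_add_right _ _) ?_
          intro e he v hv
          rw [Multiset.eq_of_mem_replicate he] at hv
          simpa using hv
        simpa using Multiset.card_le_card hle
    · refine ⟨U, subset_rfl, hverts ▸ h1, h2, h3.trans (Multiset.card_le_card (le_edgesIn ?_ ?_))⟩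
      · rw [hedges]
        refine le_trans ?_ (Multiset.le_add_left _ _)
        refine Multiset.le_filter.mpr ⟨G.edgesIn_le U, ?_⟩
        rintro e' he' rfl
        exact heU (mem_edgesIn.mp he').2
      · exact fun _ h => (mem_edgesIn.mp h).2

/-- The new edge counts for U only if both its ends are in U. Adding v then replaces it by two
edges: one more vertex, one more edge. -/
lemma dense_insert_of_bypass {v x y : V} (hv : v ∈ G.verts) (hloop : s(v, v) ∉ G.edges)
    (hxy : G.edges.filter (fun e => v ∈ e) = {s(v, x), s(v, y)})
    (hverts : G'.verts = (G.deleteVerts {v}).verts)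
    (hedges : G'.edges = s(x, y) ::ₘ (G.deleteVerts {v}).edges) {U : Finset V}
    (hU : G'.Dense U) :
    v ∉ U ∧ G.Dense (if x ∈ U ∧ y ∈ U then insert v U else U) := by
  obtain ⟨h1, h2, h3⟩ := hU
  obtain ⟨hxv, hyv⟩ := ne_of_bypass hloop hxy
  rw [hverts] at h1
  have hvU : v ∉ U := fun h => by simpa using (Finset.mem_sdiff.mp (h1 h)).2
  have hUG : U ⊆ G.verts := h1.trans Finset.sdiff_subset
  rw [card_edgesIn_bypass hvU hedges] at h3
  refine ⟨hvU, ?_⟩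
  split_ifs with hc
  · refine ⟨Finset.insert_subset hv hUG, by simp, ?_⟩
    rw [card_edgesIn_insert_bypass hvU hxv hyv hxy, Finset.card_insert_of_notMem hvU]
    simp only [hc, and_self, if_true] at h3 ⊢
    omega
  · simp only [hc, if_false] at h3
    exact ⟨hUG, h2, h3⟩

/-- If the bypassed vertex belongs to F, its neighbour x can take its place, since v is needed only
for dense sets using the new edge, and these contain x. -/
lemma exists_hits (h : ReductionStep G G') {F : Finset V} (hF : G.Hits F) :
    ∃ F' : Finset V, F'.card ≤ F.card ∧ G'.Hits F' := by
  cases h with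
  | deleteLeaf v hv hdeg h =>
    subst h
    exact ⟨F, le_rfl, fun U hU => hF U (dense_deleteVerts.mp hU).1⟩
  | bypass v x y hv hdeg hloop hxy hverts hedges =>
    by_cases hvF : v ∈ F
    · refine ⟨insert x (F.erase v), ?_, ?_⟩
      · have := Finset.card_insert_le x (F.erase v)
        have := Finset.card_erase_add_one hvF
        omega
      · intro U hU hd
        obtain ⟨hvU, hdense⟩ := dense_insert_of_bypass hv hloop hxy hverts hedges hU
        refine hF _ hdense (Finset.disjoint_left.mpr fun w hw hwF => ?_)
        rw [Finset.disjoint_left] at hd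
        by_cases hwv : w = v
        · subst hwv
          split_ifs at hw with hc
          · exact hd hc.1 (Finset.mem_insert_self _ _)
          · exact hvU hw
        · have hwU : w ∈ U := by
            split_ifs at hw with hc
            · exact (Finset.mem_insert.mp hw).resolve_left hwv
            · exact hw
          exact hd hwU (Finset.mem_insert_of_mem (Finset.mem_erase.mpr ⟨hwv, hwF⟩))
    · refine ⟨F, le_rfl, fun U hU hd => ?_⟩
      obtain ⟨hvU, hdense⟩ := dense_insert_of_bypass hv hloop hxy hverts hedges hU
      refine hF _ hdense ?_
      split_ifs
      · exact Finset.disjoint_insert_left.mpr ⟨hvF, hd⟩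
      · exact hd
  | trim e he hverts hedges =>
    exact ⟨F, le_rfl, fun U hU => hF U (hU.of_trim he hverts hedges)⟩

/-- Packings lift back through a reduction: a bypassed vertex is restored only to a set containing
both x and y, and disjoint sets cannot both contain them. -/
lemma exists_map_dense (h : ReductionStep G G') :
    ∃ f : Finset V → Finset V, (∀ U, G'.Dense U → G.Dense (f U)) ∧
      ∀ U W, G'.Dense U → G'.Dense W → Disjoint U W → Disjoint (f U) (f W) := by
  cases h with
  | deleteLeaf v hv hdeg h =>
    subst h
    exact ⟨id, fun U hU => (dense_deleteVerts.mp hU).1, fun _ _ _ _ h => h⟩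
  | bypass v x y hv hdeg hloop hxy hverts hedges =>
    have key := fun {U} (hU : G'.Dense U) =>
      dense_insert_of_bypass hv hloop hxy hverts hedges hU
    refine ⟨_, fun U hU => (key hU).2, fun U W hU hW hd => ?_⟩
    split_ifs with h1 h2 h2
    · exact absurd h2.1 (Finset.disjoint_left.mp hd h1.1)
    · exact Finset.disjoint_insert_left.mpr ⟨(key hW).1, hd⟩
    · exact Finset.disjoint_insert_right.mpr ⟨(key hU).1, hd⟩
    · exact hd
  | trim e he hverts hedges =>
    exact ⟨id, fun U hU => hU.of_trim he hverts hedges, fun _ _ _ _ h => h⟩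

lemma card_lt (h : ReductionStep G G') :
    G'.verts.card + G'.edges.card < G.verts.card + G.edges.card := by
  have hdel : ∀ v ∈ G.verts, (G.deleteVerts {v}).verts.card + 1 = G.verts.card := by
    intro v hv
    have : (G.deleteVerts {v}).verts = G.verts.erase v := by
      simp [deleteVerts, Finset.sdiff_singleton_eq_erase]
    rw [this, Finset.card_erase_add_one hv]
  cases h with
  | deleteLeaf v hv hdeg h =>
    subst h
    have h1 := hdel v hv
    have h2 : (G.deleteVerts {v}).edges.card ≤ G.edges.card :=
      Multiset.card_le_card (Multiset.filter_le _ _)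
    omega
  | bypass v x y hv hdeg hloop hxy hverts hedges =>
    have h1 := hdel v hv
    have h2 : (G.deleteVerts {v}).edges.card + 2 ≤ G.edges.card := by
      have h3 := congrArg Multiset.card (Multiset.filter_add_not (fun e => v ∈ e) G.edges)
      rw [hxy, Multiset.card_add] at h3
      have h4 : (G.deleteVerts {v}).edges = G.edges.filter (fun e => ¬ v ∈ e) := by
        simp [deleteVerts]
      rw [h4]
      simp at h3
      omega
    rw [hverts, hedges, Multiset.card_cons]
    omega
  | trim e he hverts hedges =>
    have h3 := congrArg Multiset.card (Multiset.filter_add_not (fun e' => e' = e) G.edges)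
    rw [Multiset.filter_eq', Multiset.card_add, Multiset.card_replicate] at h3
    rw [hverts, hedges, Multiset.card_add, Multiset.card_replicate]
    simp only [ne_eq]
    omega

end ReductionStep

lemma IsReduce.exists_hits {G R : MultiGraph V} (h : G.IsReduce R) {F : Finset V}
    (hF : G.Hits F) : ∃ F' : Finset V, F'.card ≤ F.card ∧ R.Hits F' := by
  obtain ⟨h, -⟩ := h
  induction h with
  | refl => exact ⟨F, le_rfl, hF⟩
  | tail _ hstep ih =>
    obtain ⟨F', h1, h2⟩ := ih
    obtain ⟨F'', h3, h4⟩ := hstep.exists_hits h2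
    exact ⟨F'', h3.trans h1, h4⟩

lemma IsFeedbackVertexSet.hits {G : MultiGraph V} {F : Finset V} (h : G.IsFeedbackVertexSet F) :
    G.Hits F := by
  intro U hU hd
  obtain ⟨C, hC, -⟩ := (dense_deleteVerts.mpr ⟨hU, hd⟩).exists_isCycle
  exact h.2 C hC

lemma Hits.isFeedbackVertexSet {G : MultiGraph V} {F : Finset V} (h : G.Hits F) :
    G.IsFeedbackVertexSet (F ∩ G.verts) := by
  refine ⟨Finset.inter_subset_right, fun C hC => ?_⟩
  obtain ⟨h1, h2⟩ := dense_deleteVerts.mp hC.dense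
  refine h _ h1 (Finset.disjoint_left.mpr fun v hv hvF => ?_)
  exact Finset.disjoint_left.mp h2 hv (Finset.mem_inter.mpr ⟨hvF, h1.1 hv⟩)

/-! ### The size bound and the Erdős–Pósa theorem -/

/-- The size bound for irreducible multigraphs without short cycles. -/
theorem Irreducible.card_verts_le_or {R : MultiGraph V} (hR : R.Irreducible) {h : ℕ} (hh : 1 ≤ h)
    (hgirth : ∀ U, R.Dense U → 8 * h < U.card) {F : Finset V} (hF : R.Hits F) {r x : ℝ}
    (hr : F.card ≤ r) (hx : 0 ≤ x) :
    (R.verts.card : ℝ) ≤ 3 * r + 2 * r * x ∨ x ^ h ≤ r := by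
  set F' := F ∩ R.verts with hF'
  have hF'r : (F'.card : ℝ) ≤ r :=
    le_trans (by exact_mod_cast Finset.card_le_card Finset.inter_subset_left) hr
  have hFV : F' ⊆ R.verts := Finset.inter_subset_right
  have hs := locallySparse_toSimple (G := R) (subset_refl R.verts) (fun U _ => hgirth U)
  by_cases hlt : 2 * (1 + x) * F'.card < (R.verts \ F').card
  · right
    refine (hs.pow_le_card_of_forest hh hx hFV ?_ (fun v hv => ?_) hlt).trans hF'r
    · refine locallySparse_toSimple Finset.sdiff_subset fun U hU hUd => ?_
      refine absurd (Finset.disjoint_left.mpr fun v hv hvF => ?_) (hF U hUd)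
      have := Finset.mem_sdiff.mp (hU hv)
      exact this.2 (Finset.mem_inter.mpr ⟨hvF, this.1⟩)
    · exact hR.three_le_card_nbrs (fun U hU => by have := hgirth U hU; omega) hv
  · left
    have h1 : ((R.verts \ F').card : ℝ) + F'.card = R.verts.card := by
      exact_mod_cast Finset.card_sdiff_add_card_eq_card hFV
    nlinarith

/-- An irreducible multigraph has a cycle of logarithmic length. -/
theorem Irreducible.two_pow_le_card_verts {R : MultiGraph V} (hR : R.Irreducible) {m : ℕ}
    (hm : 1 ≤ m) (hgirth : ∀ U, R.Dense U → 2 * m < U.card) (hne : R.verts.Nonempty) :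
    2 ^ m ≤ R.verts.card :=
  (locallySparse_toSimple (subset_refl R.verts) (fun U _ => hgirth U)).two_pow_le_card hne
    fun _ hv => hR.three_le_card_nbrs (fun U hU => by have := hgirth U hU; omega) hv

/-- The size bound with x = 2 gives |R| ≤ 7|F| or 2^h ≤ |F|; in the first case, the exponential
lower bound on |R| finishes. So a shortest cycle is logarithmic in |F|. -/
lemma Irreducible.two_pow_le_of_minimal {R : MultiGraph V} (hR : R.Irreducible) {U F : Finset V}
    (hU : R.Dense U) (hmin : ∀ W, R.Dense W → U.card ≤ W.card) (hF : R.Hits F) {h : ℕ}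
    (hh : 8 * h < U.card) : (2 : ℝ) ^ h ≤ 7 * F.card := by
  rcases Nat.eq_zero_or_pos h with rfl | hpos
  · obtain ⟨v, -, hv⟩ := Finset.not_disjoint_iff.mp (hF U hU)
    have : (1 : ℝ) ≤ F.card := by exact_mod_cast Finset.card_pos.mpr ⟨v, hv⟩
    rw [pow_zero]; linarith
  · rcases hR.card_verts_le_or hpos (fun W hW => hh.trans_le (hmin W hW)) hF le_rfl
      (zero_le_two (α := ℝ)) with h1 | h1
    · have h2 := hR.two_pow_le_card_verts (m := 4 * h) (by omega)
        (fun W hW => by have := hmin W hW; omega) (hU.2.1.mono hU.1)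
      have h3 : (2 : ℝ) ^ (4 * h) ≤ R.verts.card := by exact_mod_cast h2
      have h4 : (2 : ℝ) ^ h ≤ 2 ^ (4 * h) := pow_le_pow_right₀ one_le_two (by omega)
      linarith
    · have : (0 : ℝ) ≤ F.card := Nat.cast_nonneg _
      linarith

/-- If y = l/256 exceeded log(k+1), then f + l would be O(y·2^y), whereas h ≥ 32y − 1 makes 2^h far
larger. -/
lemma le_mul_logb_of_two_pow_le {k l h : ℕ} {f : ℝ} (hk : 1 ≤ k)
    (hf : f ≤ 256 * k * Real.logb 2 k) (hl : l ≤ 8 * h + 8)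
    (hpow : (2 : ℝ) ^ h ≤ 7 * (f + l)) : (l : ℝ) ≤ 256 * Real.logb 2 (k + 1) := by
  by_contra! hlt
  have hk' : (1 : ℝ) ≤ k := by exact_mod_cast hk
  have hlog1 : 1 ≤ Real.logb 2 (k + 1) := by
    rw [Real.le_logb_iff_rpow_le one_lt_two (by linarith), Real.rpow_one]; linarith
  have hmono : Real.logb 2 k ≤ Real.logb 2 (k + 1) :=
    Real.logb_le_logb_of_le one_lt_two (by linarith) (by linarith)
  set y : ℝ := l / 256 with hy
  have hly : (l : ℝ) = 256 * y := by rw [hy]; ring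
  have hy1 : Real.logb 2 (k + 1) < y := by rw [hy, lt_div_iff₀ (by norm_num)]; linarith
  have hk2 : (k : ℝ) + 1 < 2 ^ y := (Real.logb_lt_iff_lt_rpow one_lt_two (by linarith)).mp hy1
  have hy0 : 1 < y := by linarith
  have h1 : f ≤ 256 * (2 ^ y * y) := by
    have : (k : ℝ) * Real.logb 2 k ≤ 2 ^ y * y :=
      mul_le_mul (by linarith) (by linarith) (Real.logb_nonneg one_lt_two hk') (by positivity)
    linarith
  have h2 : (2 : ℝ) ^ (32 * y - 1) ≤ 2 ^ h := by
    rw [← Real.rpow_natCast 2 h]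
    refine Real.rpow_le_rpow_of_exponent_le one_le_two ?_
    have : (l : ℝ) ≤ 8 * h + 8 := by exact_mod_cast hl
    linarith
  have hyy : 1 + y ≤ (2 : ℝ) ^ y := by
    have := one_add_mul_self_le_rpow_one_add (s := 1) (by norm_num) hy0.le
    norm_num at this
    exact this
  have h3 : (2 : ℝ) ^ (32 * y - 1) = 2 ^ (30 * y - 1) * (2 ^ y * 2 ^ y) := by
    rw [← Real.rpow_add two_pos, ← Real.rpow_add two_pos]; ring_nf
  have h4 : (2 : ℝ) ^ (29 : ℝ) ≤ 2 ^ (30 * y - 1) :=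
    Real.rpow_le_rpow_of_exponent_le one_le_two (by linarith)
  have h5 : (2 : ℝ) ^ (29 : ℝ) = 536870912 := by
    rw [show (29 : ℝ) = ((29 : ℕ) : ℝ) by norm_num, Real.rpow_natCast]; norm_num
  rw [h5] at h4
  have h6 : (0 : ℝ) < 2 ^ y * 2 ^ y := by positivity
  have h7 : (2 : ℝ) ^ y * y ≤ 2 ^ y * 2 ^ y := mul_le_mul_of_nonneg_left (by linarith) (by positivity)
  have h8 : y ≤ 2 ^ y * y := le_mul_of_one_le_left (by linarith) (by linarith)
  have h9 := mul_le_mul_of_nonneg_right h4 h6.le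
  rw [← h3] at h9
  linarith

/-- The Erdős–Pósa theorem in terms of dense sets. -/
theorem exists_disjoint_dense_or_hits (k : ℕ) (G : MultiGraph V) :
    (∃ U : Fin k → Finset V, (∀ i, G.Dense (U i)) ∧ ∀ i j, i ≠ j → Disjoint (U i) (U j)) ∨
      ∃ F : Finset V, G.Hits F ∧ (F.card : ℝ) ≤ 256 * k * Real.logb 2 k := by
  induction k generalizing G with
  | zero => exact Or.inl ⟨fun i => i.elim0, fun i => i.elim0, fun i => i.elim0⟩
  | succ k ihk =>
    -- The inner induction reduces G at fixed k + 1 until it is irreducible; the outer one then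
    -- removes a minimum dense set.
    induction hn : G.verts.card + G.edges.card using Nat.strong_induction_on generalizing G with
    | _ n ih =>
      subst hn
      by_cases hR : G.Irreducible
      · by_cases hex : ∃ U, G.Dense U
        · obtain ⟨U, hU, hmin⟩ : ∃ U, G.Dense U ∧ ∀ W, G.Dense W → U.card ≤ W.card := by
            classical
            obtain ⟨U, hU, h⟩ := Finset.exists_min_image
              (G.verts.powerset.filter fun U => G.Dense U) Finset.card
              (by obtain ⟨U, hU⟩ := hex; exact ⟨U, by simp [hU, hU.1]⟩)
            refine ⟨U, (Finset.mem_filter.mp hU).2, fun W hW => h W ?_⟩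
            simp [hW, hW.1]
          have hpack : (∃ W : Fin k → Finset V, (∀ i, (G.deleteVerts U).Dense (W i)) ∧
              ∀ i j, i ≠ j → Disjoint (W i) (W j)) →
              ∃ W : Fin (k + 1) → Finset V, (∀ i, G.Dense (W i)) ∧
                ∀ i j, i ≠ j → Disjoint (W i) (W j) := by
            rintro ⟨W, hW, hd⟩
            have hW' := fun i => dense_deleteVerts.mp (hW i)
            refine ⟨Fin.cons U W, fun i => ?_, fun i j hij => ?_⟩
            · refine Fin.cases ?_ (fun i => ?_) i
              · exact hU
              · exact (hW' i).1
            · revert hij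
              refine Fin.cases ?_ (fun i => ?_) i <;> refine Fin.cases ?_ (fun j => ?_) j
              · exact fun h => absurd rfl h
              · exact fun _ => (hW' j).2.symm
              · exact fun _ => (hW' i).2
              · exact fun h => hd i j fun hij => h (hij ▸ rfl)
          rcases Nat.eq_zero_or_pos k with rfl | hk
          · exact Or.inl (hpack ⟨fun i => i.elim0, fun i => i.elim0, fun i => i.elim0⟩)
          rcases ihk (G.deleteVerts U) with h | ⟨F, hF, hFc⟩
          · exact Or.inl (hpack h)
          · right
            have hhit : G.Hits (F ∪ U) := by
              intro W hW hd
              rw [Finset.disjoint_union_right] at hd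
              exact hF W (dense_deleteVerts.mpr ⟨hW, hd.2⟩) hd.1
            have hcard : ((F ∪ U).card : ℝ) ≤ F.card + U.card := by
              exact_mod_cast Finset.card_union_le F U
            refine ⟨F ∪ U, hhit, hcard.trans ?_⟩
            have hUpos := Finset.card_pos.mpr hU.2.1
            -- This is the largest h with 8h < |U|. The hitting set used contains U itself, which
            -- adds the summand l to the next estimate.
            have h1 := hR.two_pow_le_of_minimal hU hmin hhit (h := (U.card - 1) / 8) (by omega)
            have h2 := le_mul_logb_of_two_pow_le (l := U.card) (f := F.card) hk hFc
              (by omega : U.card ≤ 8 * ((U.card - 1) / 8) + 8) (h1.trans (by linarith))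
            have hk' : (1 : ℝ) ≤ k := by exact_mod_cast hk
            have h3 : Real.logb 2 k ≤ Real.logb 2 (k + 1) :=
              Real.logb_le_logb_of_le one_lt_two (by linarith) (by linarith)
            push_cast
            nlinarith
        · refine Or.inr ⟨∅, fun U hU => absurd ⟨U, hU⟩ hex, ?_⟩
          rw [Finset.card_empty, Nat.cast_zero]
          have : 0 ≤ Real.logb 2 ((k + 1 : ℕ) : ℝ) :=
            Real.logb_nonneg one_lt_two (by exact_mod_cast Nat.succ_le_succ (Nat.zero_le k))
          positivity
      · unfold Irreducible at hR
        push Not at hR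
        obtain ⟨G', hstep⟩ := hR
        rcases ih _ hstep.card_lt G' rfl with ⟨U, hU, hd⟩ | ⟨F, hF, hFc⟩
        · obtain ⟨f, hf, hfd⟩ := hstep.exists_map_dense
          exact Or.inl ⟨fun i => f (U i), fun i => hf _ (hU i),
            fun i j hij => hfd _ _ (hU i) (hU j) (hd i j hij)⟩
        · refine Or.inr ⟨F, fun U hU hd => ?_, hFc⟩
          obtain ⟨U', hsub, hU'⟩ := hstep.exists_dense_subset hU
          exact hF U' hU' (Finset.disjoint_of_subset_left hsub hd)

/-! ### The girth parameter -/

/-- The size bound at the girth parameter. -/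
theorem Irreducible.card_verts_le_of_girthParameter {R : MultiGraph V} (hR : R.Irreducible) {k : ℕ}
    (hk : 3 ≤ k) (hgirth : ∀ C, R.IsShortestCycle C → girthParameter k < C.length)
    {F : Finset V} (hF : R.Hits F) {r K : ℝ} (hK : 1 ≤ K) (hr : F.card ≤ r)
    (hrK : r ≤ K * k * Real.logb 2 k ^ 2) :
    (R.verts.card : ℝ) ≤ 3 * r + 2 * r * (K * √(Real.logb 2 k)) := by
  set L := Real.logb 2 k with hL
  have hk' : (3 : ℝ) ≤ k := by exact_mod_cast hk
  have hL1 : 1 < L := by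
    rw [hL, Real.lt_logb_iff_rpow_lt one_lt_two (by linarith), Real.rpow_one]; linarith
  set lam := Real.logb 2 L with hlam
  have hlam0 : 0 < lam := Real.logb_pos one_lt_two hL1
  have hLpow : (2 : ℝ) ^ lam = L := Real.rpow_logb two_pos (by norm_num) (by linarith)
  have hkpow : (2 : ℝ) ^ L = k := Real.rpow_logb two_pos (by norm_num) (by linarith)
  -- From exp t ≥ e·t at t = λ ln 2, where L = 2^λ, and e·ln 2 > 1.8.
  have hlamL : 1.8 * lam ≤ L := by
    have h1 := Real.exp_one_mul_le_exp (x := Real.log 2 * lam)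
    rw [← Real.rpow_def_of_pos two_pos, hLpow] at h1
    have h2 := Real.exp_one_gt_d9
    have h3 := Real.log_two_gt_d9
    have h4 : (1.8 : ℝ) ≤ Real.exp 1 * Real.log 2 := by nlinarith
    nlinarith
  set g := girthParameter k with hg
  have hgdef : g = 48 * L / lam + 6 := rfl
  have hglam : g * lam = 48 * L + 6 * lam := by
    rw [hgdef]; field_simp
  set h := ⌊g / 8⌋₊ with hh
  have hg0 : 8 ≤ g := by
    by_contra! hlt
    nlinarith
  have hh1 : 1 ≤ h := Nat.le_floor (by rw [Nat.cast_one, le_div_iff₀ (by norm_num)]; linarith)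
  have hhg : 8 * (h : ℝ) ≤ g := by
    have := Nat.floor_le (show 0 ≤ g / 8 by linarith)
    linarith
  have hhlt : g / 8 < h + 1 := Nat.lt_floor_add_one _
  have hdense : ∀ U, R.Dense U → 8 * h < U.card := by
    intro U hU
    by_contra! hle
    obtain ⟨C, hC, hmin⟩ : ∃ C, R.IsCycle C ∧ ∀ C', R.IsCycle C' → C.length ≤ C'.length := by
      obtain ⟨C, hC, -⟩ := hU.exists_isCycle
      have hex : ∃ n, ∃ C, R.IsCycle C ∧ C.length = n := ⟨_, C, hC, rfl⟩
      classical
      obtain ⟨C', hC', hlen⟩ := Nat.find_spec hex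
      exact ⟨C', hC', fun D hD => hlen ▸ Nat.find_min' hex ⟨D, hD, rfl⟩⟩
    obtain ⟨D, hD, hDU⟩ := hU.exists_isCycle
    have h1 := hgirth C ⟨hC, hmin⟩
    have h2 : D.length ≤ U.card := by
      rw [← List.toFinset_card_of_nodup hD.2.1]
      exact Finset.card_le_card hDU
    have h3 : (C.length : ℝ) ≤ 8 * h := by exact_mod_cast (hmin D hD).trans (h2.trans hle)
    linarith
  rcases hR.card_verts_le_or hh1 hdense hF hr (x := K * √L) (by positivity) with h1 | h1
  · exact h1
  · exfalso
    have hsqrt : √L = (2 : ℝ) ^ (lam / 2) := by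
      rw [Real.sqrt_eq_rpow, ← hLpow, ← Real.rpow_mul zero_le_two]
      ring_nf
    have hx : (K * √L) ^ h = K ^ h * 2 ^ (lam / 2 * h) := by
      rw [mul_pow, hsqrt, ← Real.rpow_mul_natCast zero_le_two]
    have hKh : K ≤ K ^ h := le_self_pow₀ hK (by omega)
    -- Since h > g/8 − 1 = 6L/λ − 1/4, the right side exceeds 3L − λ/8, and 2L ≥ 3.6λ.
    have hexp : L + 2 * lam < lam / 2 * h := by nlinarith
    have hLL : (k : ℝ) * L ^ 2 = 2 ^ (L + 2 * lam) := by
      rw [Real.rpow_add two_pos, hkpow, mul_comm 2 lam, Real.rpow_mul zero_le_two, hLpow,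
        Real.rpow_two]
    have hlt : (2 : ℝ) ^ (L + 2 * lam) < 2 ^ (lam / 2 * h) :=
      Real.rpow_lt_rpow_of_exponent_lt one_lt_two hexp
    have : r < K ^ h * 2 ^ (lam / 2 * h) := by
      calc r ≤ K * 2 ^ (L + 2 * lam) := by rw [← hLL, ← mul_assoc]; exact hrK
        _ < K * 2 ^ (lam / 2 * h) := by gcongr
        _ ≤ K ^ h * 2 ^ (lam / 2 * h) := by gcongr
    rw [hx] at h1
    linarith

end MultiGraph

/-! ### The Erdős–Pósa constant and the two bounds -/

theorem isErdosPosaConstant_of_le {c : ℝ} (hc : 256 ≤ c) : IsErdosPosaConstant.{u} c := by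
  intro V _ G k
  rcases G.exists_disjoint_dense_or_hits k with ⟨U, hU, hd⟩ | ⟨F, hF, hFc⟩
  · choose C hC hCU using fun i => (hU i).exists_isCycle
    refine Or.inl ⟨C, hC, fun i j hij v hvi hvj => ?_⟩
    exact Finset.disjoint_left.mp (hd i j hij) (hCU i (List.mem_toFinset.mpr hvi))
      (hCU j (List.mem_toFinset.mpr hvj))
  · refine Or.inr ⟨_, hF.isFeedbackVertexSet, ?_⟩
    have h1 : ((F ∩ G.verts).card : ℝ) ≤ F.card := by
      exact_mod_cast Finset.card_le_card Finset.inter_subset_left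
    refine h1.trans (hFc.trans ?_)
    have h2 : 0 ≤ Real.logb 2 k := by
      rcases Nat.eq_zero_or_pos k with rfl | hk
      · simp
      · exact Real.logb_nonneg one_lt_two (by exact_mod_cast hk)
    gcongr

theorem corollary1 :
    (∀ c : ℝ, 2 < c → ∀ k : ℕ, c < Real.logb 2 k →
      ∀ (V : Type u) [DecidableEq V] (G : MultiGraph V) (S : Finset V) (R : MultiGraph V),
        G.AlgorithmReturns c k (girthParameter k) S R →
        (R.verts.card : ℝ) ≤
          3 * c * k * Real.logb 2 k + 2 * c * k * Real.logb 2 k ^ (1.5 : ℝ)) ∧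
    (∃ c : ℝ, 2 < c ∧ IsErdosPosaConstant.{u} c ∧
      ∀ k : ℕ, 3 ≤ k →
      ∀ (V : Type u) [DecidableEq V] (G : MultiGraph V) (S : Finset V) (R : MultiGraph V),
        ¬ G.HasDisjointCycles k →
        G.AlgorithmReturns c k (girthParameter k) S R →
        (R.verts.card : ℝ) ≤
          3 * c * k * Real.logb 2 k + 2 * c * k * Real.logb 2 k ^ (1.5 : ℝ)) := by
  have hpow : ∀ L : ℝ, 0 < L → L ^ (1.5 : ℝ) = L * √L := by
    intro L hL
    rw [show (1.5 : ℝ) = 1 + 1 / 2 by norm_num, Real.rpow_add hL, Real.rpow_one,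
      Real.sqrt_eq_rpow]
  have hits : ∀ (V : Type u) [DecidableEq V] (G R : MultiGraph V) (S F : Finset V),
      G.IsFeedbackVertexSet F → (G.deleteVerts S).IsReduce R →
      ∃ F' : Finset V, F'.card ≤ F.card ∧ R.Hits F' := fun V _ G R S F hF hR =>
    hR.exists_hits fun U hU => hF.hits U (MultiGraph.dense_deleteVerts.mp hU).1
  -- 65536 = 256²: one factor comes from the feedback vertex set of size 256·k·log k, the other from
  -- K = 256, which covers small k.
  refine ⟨?_, 65536, by norm_num, isErdosPosaConstant_of_le (by norm_num), ?_⟩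
  · rintro c hc k hck V _ G S R ⟨⟨F, hF, hFc⟩, m, -, -, hR, hgirth⟩
    set L := Real.logb 2 k with hL
    obtain ⟨F', hF'c, hF'⟩ := hits V G R S F hF hR
    have hk : 3 ≤ k := by
      by_contra! hlt
      have h1 : (k : ℝ) ≤ 2 := by exact_mod_cast Nat.le_of_lt_succ hlt
      rcases Nat.eq_zero_or_pos k with rfl | hk0
      · simp at hL; linarith
      · have : L ≤ 1 := by
          rw [hL, Real.logb_le_iff_le_rpow one_lt_two (by exact_mod_cast hk0), Real.rpow_one]
          exact h1
        linarith
    have hk0 : (0 : ℝ) ≤ k := Nat.cast_nonneg k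
    have hr : (F'.card : ℝ) ≤ c * k * L := le_trans (by exact_mod_cast hF'c) hFc
    -- K = 1 is enough here, because c < L gives c·k·L ≤ k·L².
    have := MultiGraph.Irreducible.card_verts_le_of_girthParameter hR.2 hk hgirth hF' le_rfl hr (by
      rw [← hL]
      have : 0 ≤ k * L := mul_nonneg hk0 (by linarith)
      nlinarith)
    rw [← hL] at this
    rw [hpow L (by linarith)]
    refine this.trans_eq (by ring)
  · rintro k hk V _ G S R hno ⟨-, m, -, -, hR, hgirth⟩
    set L := Real.logb 2 k with hL
    -- Without k disjoint cycles there is a feedback vertex set with the smaller constant 256, which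
    -- leaves room for the factor K.
    obtain ⟨F, hF, hFc⟩ := (isErdosPosaConstant_of_le le_rfl V G k).resolve_left hno
    obtain ⟨F', hF'c, hF'⟩ := hits V G R S F hF hR
    have hk' : (3 : ℝ) ≤ k := by exact_mod_cast hk
    have hL1 : 1 < L := by
      rw [hL, Real.lt_logb_iff_rpow_lt one_lt_two (by linarith), Real.rpow_one]; linarith
    have hr : (F'.card : ℝ) ≤ 256 * k * L := le_trans (by exact_mod_cast hF'c) hFc
    have hkL : 0 ≤ k * L := by positivity
    have := MultiGraph.Irreducible.card_verts_le_of_girthParameter hR.2 hk hgirth hF'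
      (K := 256) (by norm_num) hr (by rw [← hL]; nlinarith)
    rw [← hL] at this
    rw [hpow L (by linarith)]
    nlinarith [mul_nonneg hkL (Real.sqrt_nonneg L)]
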